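/- For $\lambda\in\mathbb C$ and real $x,t$ let $$f(\lambda)=\exp\bigl(\mathrm i(\lambda^2x+2\lambda^4t)\bigr),\qquad g(\lambda)=\exp\bigl(-\mathrm i(\lambda^2x+2\lambda^4t)\bigr),$$ so that $\Psi=(f,g)^T$ is the eigenfunction with eigenvalue $\lambda$ of the Kaup--Newell Lax pair for the vacuum $q=r=0$. Let $\lambda_1=\alpha_1+\mathrm i\beta_1$ with $\alpha_1,\beta_1\in\mathbb R$, $\alpha_1\neq0$, let $\lambda_2=-\lambda_1^*$ (where $^*$ is complex conjugation), let $k\ge1$ and $n=2k$, and write $$f[i,j,l]=\frac1{l!}\frac{\partial^l(\lambda^jf(\lambda))}{\partial\lambda^l}\Big|_{\lambda=\lambda_i},\qquad g[i,j,l]=\frac1{l!}\frac{\partial^l(\lambda^jg(\lambda))}{\partial\lambda^l}\Big|_{\lambda=\lambda_i}\qquad(i=1,2).$$ Let $\delta_{11},\delta_{12},\delta_{21}$ be the $n\times n$ determinants whose rows, in the order $(i,l)=(1,0),(2,0),(1,1),(2,1),\dots,(1,k-1),(2,k-1)$, are - for $\delta_{11}$: $\;g[i,n-1,l],\ f[i,n-2,l],\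 g[i,n-3,l],\ \dots,\ g[i,1,l],\ f[i,0,l]$; - for $\delta_{12}$: the same, except that the first entry is $f[i,n,l]$; - for $\delta_{21}$: $\;f[i,n-1,l],\ g[i,n-2,l],\ f[i,n-3,l],\ \dots,\ f[i,1,l],\ g[i,0,l]$. Then $\delta_{21}(x,t)\ne0$ for all $x,t\in\mathbb R$, and $$q^{[n]}=2\mathrm i\,\frac{\delta_{11}\delta_{12}}{\delta_{21}^2}$$ is a smooth solution on $\mathbb R^2$ of the derivative nonlinear Schrödinger (DNLS) equation $\mathrm iq_t-q_{xx}+\mathrm i(|q|^2q)_x=0$. It is the solution generated by the $n$-fold Darboux transformation at the same eigenvalue: for pairwise distinct $\mu_1,\dots,\mu_k\in\mathbb C$ put $\nu_{2l-1}=\mu_l$, $\nu_{2l}=-\mu_l^*$, $(f_{2l-1},g_{2l-1})=(f(\mu_l),g(\mu_l))$, $(f_{2l},g_{2l})=(g_{2l-1}^*,f_{2l-1}^*)$, and let $\Omega_{11},\Omega_{12},\Omega_{21}$ be the $n\times n$ determinants whose $m$-th rows are $(\nu_m^{n-1}g_m,\nu_m^{n-2}f_m,\nu_m^{n-3}g_m,\dots,\nu_mg_m,f_m)$,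 the same with first entry $\nu_m^nf_m$, and $(\nu_m^{n-1}f_m,\nu_m^{n-2}g_m,\nu_m^{n-3}f_m,\dots,\nu_mf_m,g_m)$, respectively. Then for all $x,t$, $\;2\mathrm i\,\Omega_{11}\Omega_{12}/\Omega_{21}^2\to q^{[n]}(x,t)$ as $(\mu_1,\dots,\mu_k)\to(\lambda_1,\dots,\lambda_1)$ through tuples of pairwise distinct numbers. Moreover, for every real $\beta_1\ne0$ the formula yields a rational travelling solution in the limit $\alpha_1\to0$: there are complex polynomials $P,Q$ in two variables, with $Q(x,t)\neq0$ for all real $x,t$, such that $$\lim_{\alpha_1\to0,\ \alpha_1\neq 0}q^{[n]}(x,t)=e^{2\mathrm i\beta_1^2(2\beta_1^2t-x)}\,\frac{P(x,t)}{Q(x,t)}\qquad(x,t\in\mathbb R),$$ and this limit is a smooth solution of the DNLS equation on $\mathbb R^2$. -/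

import Mathlib

open Complex Filter Topology
open scoped ContDiff

namespace DNLS

/-- `q : ℝ → ℝ → ℂ`, `(x, t) ↦ q x t`, is a smooth solution on the whole `(x, t)`-plane of the
derivative nonlinear Schrödinger equation `i q_t - q_xx + i (|q|² q)_x = 0`. -/
def IsSolution (q : ℝ → ℝ → ℂ) : Prop :=
  ContDiff ℝ ∞ (fun p : ℝ × ℝ => q p.1 p.2) ∧
  ∀ x t : ℝ,
    I * deriv (fun s : ℝ => q x s) t - iteratedDeriv 2 (fun y : ℝ => q y t) x
      + I * deriv (fun y : ℝ => ((‖q y t‖ ^ 2 : ℝ) : ℂ) * q y t) x = 0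

/-- First component `f = exp (i (λ² x + 2 λ⁴ t))` of the eigenfunction of the vacuum `q = r = 0`. -/
noncomputable def vacF (x t : ℝ) (z : ℂ) : ℂ := exp (I * (z ^ 2 * x + 2 * z ^ 4 * t))

/-- Second component `g = exp (-i (λ² x + 2 λ⁴ t))` of the eigenfunction of the vacuum. -/
noncomputable def vacG (x t : ℝ) (z : ℂ) : ℂ := exp (-(I * (z ^ 2 * x + 2 * z ^ 4 * t)))

/-- The entry in column `c` of the row
`(λ^(n-1) g, λ^(n-2) f, λ^(n-3) g, …, λ g, f)` with `n = 2k`. -/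
def entry11 (k : ℕ) (c : Fin (2 * k)) (z f g : ℂ) : ℂ :=
  z ^ (2 * k - 1 - (c : ℕ)) * (if (c : ℕ) % 2 = 0 then g else f)

/-- The entry in column `c` of the row
`(λ^n f, λ^(n-2) f, λ^(n-3) g, …, λ g, f)` with `n = 2k`. -/
def entry12 (k : ℕ) (c : Fin (2 * k)) (z f g : ℂ) : ℂ :=
  if (c : ℕ) = 0 then z ^ (2 * k) * f else entry11 k c z f g

/-- The entry in column `c` of the row
`(λ^(n-1) f, λ^(n-2) g, λ^(n-3) f, …, λ f, g)` with `n = 2k`. -/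
def entry21 (k : ℕ) (c : Fin (2 * k)) (z f g : ℂ) : ℂ :=
  z ^ (2 * k - 1 - (c : ℕ)) * (if (c : ℕ) % 2 = 0 then f else g)

/-- The `l`-th Taylor coefficient `F^(l)(a) / l!` of `F : ℂ → ℂ` at `a`. -/
noncomputable def taylorCoeff (F : ℂ → ℂ) (l : ℕ) (a : ℂ) : ℂ :=
  iteratedDeriv l F a / (l.factorial : ℂ)

/-- The `2k × 2k` determinant whose rows number `2l` and `2l + 1` (counted from `0`, with
`l = 0, …, k-1`) consist of the `l`-th Taylor coefficients in the spectral parameter, at `lam₁` and at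
`lam₂` respectively, of the entries `e` evaluated on the vacuum eigenfunction. -/
noncomputable def taylorDet (k : ℕ) (e : Fin (2 * k) → ℂ → ℂ → ℂ → ℂ) (lam₁ lam₂ : ℂ)
    (x t : ℝ) : ℂ :=
  Matrix.det (Matrix.of fun r c : Fin (2 * k) =>
    taylorCoeff (fun z => e c z (vacF x t z) (vacG x t z)) ((r : ℕ) / 2)
      (if (r : ℕ) % 2 = 0 then lam₁ else lam₂))

noncomputable def delta11 (k : ℕ) (lam₁ lam₂ : ℂ) (x t : ℝ) : ℂ :=
  taylorDet k (entry11 k) lam₁ lam₂ x t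

noncomputable def delta12 (k : ℕ) (lam₁ lam₂ : ℂ) (x t : ℝ) : ℂ :=
  taylorDet k (entry12 k) lam₁ lam₂ x t

noncomputable def delta21 (k : ℕ) (lam₁ lam₂ : ℂ) (x t : ℝ) : ℂ :=
  taylorDet k (entry21 k) lam₁ lam₂ x t

/-- `q^[n] = 2 i δ₁₁ δ₁₂ / δ₂₁²` with `n = 2k`. -/
noncomputable def qSame (k : ℕ) (lam₁ lam₂ : ℂ) (x t : ℝ) : ℂ :=
  2 * I * (delta11 k lam₁ lam₂ x t * delta12 k lam₁ lam₂ x t) / delta21 k lam₁ lam₂ x t ^ 2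

/-- The `2k × 2k` determinant of the `2k`-fold Darboux transformation of the vacuum with the
eigenvalues `lam_{2l-1} = μ_l`, `lam_{2l} = -μ_l^*` and the eigenfunctions
`(f_{2l-1}, g_{2l-1}) = (f, g)(μ_l)`, `(f_{2l}, g_{2l}) = (g_{2l-1}^*, f_{2l-1}^*)`. -/
noncomputable def darbouxDet (k : ℕ) (e : Fin (2 * k) → ℂ → ℂ → ℂ → ℂ) (μ : Fin k → ℂ)
    (x t : ℝ) : ℂ :=
  Matrix.det (Matrix.of fun r c : Fin (2 * k) =>
    let m : ℂ := μ ⟨(r : ℕ) / 2, by omega⟩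
    if (r : ℕ) % 2 = 0 then e c m (vacF x t m) (vacG x t m)
    else e c (-(starRingEnd ℂ) m) ((starRingEnd ℂ) (vacG x t m)) ((starRingEnd ℂ) (vacF x t m)))

/-- The `2k`-fold Darboux transform `q^[n] = 2 i Ω₁₁ Ω₁₂ / Ω₂₁²`, `n = 2k`, of the vacuum at the
eigenvalues `μ_1, …, μ_k` and `-μ_1^*, …, -μ_k^*`. -/
noncomputable def qDarboux (k : ℕ) (μ : Fin k → ℂ) (x t : ℝ) : ℂ :=
  2 * I * (darbouxDet k (entry11 k) μ x t * darbouxDet k (entry12 k) μ x t)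
    / darbouxDet k (entry21 k) μ x t ^ 2

end DNLS

/-! The Darboux matrix can be built from any 2k linear functionals in the spectral parameter, not
only from evaluations at distinct points. All that is needed (`WaveSystem`) is that their common
kernel is stable under multiplication by z and under the reflection z ↦ -z^*. Taylor coefficients at
reflected points qualify, so the confluent formula solves DNLS directly, without differentiating a
limit.

The first row of the Darboux matrix is one polynomial with constant term 1 and degree at most 2k;
its even part times f plus its odd part times g is annihilated by all functionals. Reflection
supplies the second row. Differentiating the relation in x or t and subtracting suitable multiples
of both rows leaves a relation among X_1, ..., X_2k, which is trivial because the linear system is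
invertible. This yields the Lax equations for the coefficients (`deriv_coef_fst`,
`deriv_coef_one_snd`). They say that the coefficient of z is a potential b with b_x = q and b_t = -i
q_x - |q|²q; equality of mixed derivatives of b is DNLS. Cramer's rule turns q into the quotient of
determinants, up to a constant phase.

If the denominator vanished, there would be an odd a and an even b of degree below 2k such that af +
bg, and by reflection b^*f - a^*g, vanish at all points with multiplicity. Then aa^* + bb^* is even
and has at least 4k zeros but degree at most 4k - 2, so it is zero; on the real line it is |a|² +
|b|², so a = b = 0. For a real eigenvalue the points are already opposite, and parity separates af
from bg instead.

Newton interpolation factors each Darboux determinant into a nonzero factor common to all three,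
which cancels in the quotient, and a determinant of divided differences, which tend to Taylor
coefficients (`tendsto_nodeDet_ratio`). Used with two clusters this gives the coalescence limit.
Used with one cluster of 2k nodes on the imaginary axis it gives the limit α₁ → 0, where the
exponentials factor out of the columns and polynomials remain. -/

namespace DNLS

/-! ### Derivatives of the vacuum exponentials in the spectral parameter -/

/-- The common form of `vacF` (`s = i`) and `vacG` (`s = -i`). -/
noncomputable def wave (s : ℂ) (x t : ℝ) (z : ℂ) : ℂ := exp (s * (z ^ 2 * x + 2 * z ^ 4 * t))

theorem vacF_eq_wave (x t : ℝ) : vacF x t = wave I x t := rfl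

theorem vacG_eq_wave (x t : ℝ) : vacG x t = wave (-I) x t := by
  funext z; simp only [vacG, wave, neg_mul]

theorem contDiff_wave (s : ℂ) (x t : ℝ) {n : WithTop ℕ∞} : ContDiff ℂ n (wave s x t) := by
  unfold wave; fun_prop

theorem contDiff_pow_mul_wave (s : ℂ) (j : ℕ) (x t : ℝ) {n : WithTop ℕ∞} :
    ContDiff ℂ n (fun z : ℂ => z ^ j * wave s x t z) :=
  (contDiff_id.pow j).mul (contDiff_wave s x t)

/-- The `l`-th derivative at `a` of `z ^ j * wave s x t z`. -/
noncomputable def jet (s : ℂ) (l j : ℕ) (a : ℂ) (x t : ℝ) : ℂ :=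
  iteratedDeriv l (fun z => z ^ j * wave s x t z) a

theorem jet_zero (s : ℂ) (j : ℕ) (a : ℂ) (x t : ℝ) : jet s 0 j a x t = a ^ j * wave s x t a := by
  simp [jet]

theorem deriv_pow_mul_wave (s : ℂ) (j : ℕ) (x t : ℝ) :
    deriv (fun z : ℂ => z ^ j * wave s x t z) = fun z =>
      (j : ℂ) * (z ^ (j - 1) * wave s x t z) + (2 * s * x) * (z ^ (j + 1) * wave s x t z)
        + (8 * s * t) * (z ^ (j + 3) * wave s x t z) := by
  funext z
  have h1 : HasDerivAt (fun z : ℂ => s * (z ^ 2 * x + 2 * z ^ 4 * t))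
      (s * (((2 : ℕ) * z ^ (2 - 1)) * x + 2 * ((4 : ℕ) * z ^ (4 - 1)) * t)) z :=
    (((hasDerivAt_pow 2 z).mul_const _).add (((hasDerivAt_pow 4 z).const_mul 2).mul_const _)
      ).const_mul s
  have h2 := (hasDerivAt_pow j z).mul h1.cexp
  refine HasDerivAt.deriv (h2.congr_deriv ?_)
  simp only [wave]
  push_cast
  ring

/-- The innermost derivative is carried out explicitly. This recursion in `l` lets the facts below
be proved by induction, without exchanging derivatives in z with those in x and t. The truncated `j
- 1` at `j = 0` is harmless because of the factor `j`. -/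
theorem jet_succ (s : ℂ) (l j : ℕ) (a : ℂ) (x t : ℝ) :
    jet s (l + 1) j a x t = j * jet s l (j - 1) a x t + 2 * s * x * jet s l (j + 1) a x t
      + 8 * s * t * jet s l (j + 3) a x t := by
  have hc (c : ℂ) (m : ℕ) : ContDiffAt ℂ l (fun z : ℂ => c * (z ^ m * wave s x t z)) a :=
    contDiffAt_const.mul (contDiff_pow_mul_wave s m x t).contDiffAt
  unfold jet
  rw [iteratedDeriv_succ', deriv_pow_mul_wave,
    iteratedDeriv_fun_add ((hc _ _).add (hc _ _)) (hc _ _),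
    iteratedDeriv_fun_add (hc _ _) (hc _ _)]
  simp only [iteratedDeriv_const_mul_field]

/-- Leibniz' rule for the factor z. It is the source of the stability of the functionals under
multiplication by z. -/
theorem jet_mul_id (s : ℂ) (l j : ℕ) (a : ℂ) (x t : ℝ) :
    jet s l (j + 1) a x t = a * jet s l j a x t + l * jet s (l - 1) j a x t := by
  induction l generalizing j with
  | zero => simp [jet_zero, pow_succ]; ring
  | succ l ih =>
    have e1 := ih j
    have e2 := ih (j + 1)
    have e3 := ih (j + 3)
    have e0 : (j : ℂ) * jet s l j a x t
        = j * (a * jet s l (j - 1) a x t + l * jet s (l - 1) (j - 1) a x t) := by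
      rcases j with _ | j
      · simp
      · rw [Nat.add_sub_cancel, ← ih j]
    have e4 : (l : ℂ) * jet s l j a x t = l * (j * jet s (l - 1) (j - 1) a x t
        + 2 * s * x * jet s (l - 1) (j + 1) a x t + 8 * s * t * jet s (l - 1) (j + 3) a x t) := by
      rcases l with _ | l
      · simp
      · rw [jet_succ]; simp
    rw [jet_succ, jet_succ]
    simp only [Nat.add_sub_cancel, Nat.add_right_comm j 1] at *
    rw [e2, e3]
    push_cast
    linear_combination e0 - e4

theorem contDiff_jet (s : ℂ) (l j : ℕ) (a : ℂ) :
    ContDiff ℝ ∞ (fun p : ℝ × ℝ => jet s l j a p.1 p.2) := by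
  have h1 : ContDiff ℝ ∞ (fun p : ℝ × ℝ => (p.1 : ℂ)) := ofRealCLM.contDiff.comp contDiff_fst
  have h2 : ContDiff ℝ ∞ (fun p : ℝ × ℝ => (p.2 : ℂ)) := ofRealCLM.contDiff.comp contDiff_snd
  induction l generalizing j with
  | zero =>
    simp only [jet_zero, wave]
    fun_prop
  | succ l ih =>
    simp only [jet_succ]
    have := ih (j - 1); have := ih (j + 1); have := ih (j + 3)
    fun_prop

theorem hasDerivAt_jet_fst (s : ℂ) (l j : ℕ) (a : ℂ) (x t : ℝ) :
    HasDerivAt (fun y : ℝ => jet s l j a y t) (s * jet s l (j + 2) a x t) x := by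
  have h0 : HasDerivAt (fun y : ℝ => (y : ℂ)) 1 x := ofRealCLM.hasDerivAt
  induction l generalizing j with
  | zero =>
    simp only [jet_zero, wave]
    have := (((h0.const_mul (a ^ 2)).add_const (2 * a ^ 4 * (t : ℂ))).const_mul s).cexp.const_mul
      (a ^ j)
    refine this.congr_deriv ?_
    ring
  | succ l ih =>
    have h1 := ((ih (j - 1)).const_mul (j : ℂ)).add ((h0.const_mul (2 * s)).mul (ih (j + 1))) |>.add
      ((ih (j + 3)).const_mul (8 * s * t))
    simp only [jet_succ]
    refine h1.congr_deriv ?_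
    have e0 : (j : ℂ) * jet s l (j - 1 + 2) a x t = j * jet s l (j + 1) a x t := by
      rcases j with _ | j <;> simp
    simp only [show j + 2 - 1 = j + 1 by omega, add_assoc] at *
    push_cast
    linear_combination s * e0

theorem hasDerivAt_jet_snd (s : ℂ) (l j : ℕ) (a : ℂ) (x t : ℝ) :
    HasDerivAt (fun y : ℝ => jet s l j a x y) (2 * s * jet s l (j + 4) a x t) t := by
  have h0 : HasDerivAt (fun y : ℝ => (y : ℂ)) 1 t := ofRealCLM.hasDerivAt
  induction l generalizing j with
  | zero =>
    simp only [jet_zero, wave]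
    have := (((h0.const_mul (2 * a ^ 4)).const_add (a ^ 2 * (x : ℂ))).const_mul s).cexp.const_mul
      (a ^ j)
    refine this.congr_deriv ?_
    ring
  | succ l ih =>
    have h1 := ((ih (j - 1)).const_mul (j : ℂ)).add ((ih (j + 1)).const_mul (2 * s * x)) |>.add
      ((h0.const_mul (8 * s)).mul (ih (j + 3)))
    simp only [jet_succ]
    refine h1.congr_deriv ?_
    have e0 : (j : ℂ) * jet s l (j - 1 + 4) a x t = j * jet s l (j + 3) a x t := by
      rcases j with _ | j <;> simp
    simp only [show j + 4 - 1 = j + 3 by omega, add_assoc] at *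
    push_cast
    linear_combination 2 * s * e0

/-- The phase contains only even powers of z, so the reflection z ↦ -z^* merely conjugates `s`; each
power of z and each derivative in z contributes a sign. -/
theorem conj_jet (s : ℂ) (l j : ℕ) (a : ℂ) (x t : ℝ) :
    (starRingEnd ℂ) (jet s l j a x t)
      = (-1) ^ (l + j) * jet ((starRingEnd ℂ) s) l j (-(starRingEnd ℂ) a) x t := by
  induction l generalizing j with
  | zero =>
    have e : (starRingEnd ℂ) a ^ j = (-1) ^ j * (-(starRingEnd ℂ) a) ^ j := by
      rw [← mul_pow]; simp
    simp only [jet_zero, wave, map_mul, map_pow, ← exp_conj, map_add, conj_ofReal, e, zero_add,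
      map_ofNat, Even.neg_pow (show Even 2 by decide), Even.neg_pow (show Even 4 by decide)]
    ring
  | succ l ih =>
    rw [jet_succ, jet_succ]
    simp only [map_add, map_mul, ih, conj_ofReal, map_natCast, map_ofNat]
    have e0 : (j : ℂ) * (-1) ^ (l + (j - 1)) = j * (-1) ^ (l + 1 + j) := by
      rcases j with _ | j
      · simp
      · simp only [Nat.add_sub_cancel, pow_succ, pow_add]; ring
    simp only [pow_succ, pow_add] at *
    linear_combination jet ((starRingEnd ℂ) s) l (j - 1) (-(starRingEnd ℂ) a) x t * e0

/-- Each jet is the exponential factor times a polynomial in `x` and `t`. -/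
theorem exists_jet_eq_wave_mul_eval (s : ℂ) (l j : ℕ) (a : ℂ) :
    ∃ p : MvPolynomial (Fin 2) ℂ, ∀ x t : ℝ,
      jet s l j a x t = wave s x t a * MvPolynomial.eval ![(x : ℂ), (t : ℂ)] p := by
  induction l generalizing j with
  | zero => exact ⟨MvPolynomial.C (a ^ j), fun x t => by simp [jet_zero, mul_comm]⟩
  | succ l ih =>
    obtain ⟨p₁, h₁⟩ := ih (j - 1)
    obtain ⟨p₂, h₂⟩ := ih (j + 1)
    obtain ⟨p₃, h₃⟩ := ih (j + 3)
    refine ⟨MvPolynomial.C (j : ℂ) * p₁ + MvPolynomial.C (2 * s) * MvPolynomial.X 0 * p₂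
      + MvPolynomial.C (8 * s) * MvPolynomial.X 1 * p₃, fun x t => ?_⟩
    rw [jet_succ, h₁, h₂, h₃]
    simp only [map_add, map_mul, MvPolynomial.eval_C, MvPolynomial.eval_X, Matrix.cons_val_zero,
      Matrix.cons_val_one]
    ring

end DNLS

namespace DNLS

/-! ### DNLS as a conservation law -/

section Calculus

theorem contDiff_slice_fst {h : ℝ × ℝ → ℂ} (hh : ContDiff ℝ ∞ h) (t : ℝ) :
    ContDiff ℝ ∞ (fun y : ℝ => h (y, t)) :=
  hh.comp (contDiff_id.prodMk contDiff_const)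

theorem contDiff_slice_snd {h : ℝ × ℝ → ℂ} (hh : ContDiff ℝ ∞ h) (x : ℝ) :
    ContDiff ℝ ∞ (fun s : ℝ => h (x, s)) :=
  hh.comp (contDiff_const.prodMk contDiff_id)

theorem deriv_slice_fst {h : ℝ × ℝ → ℂ} (hh : Differentiable ℝ h) (x t : ℝ) :
    deriv (fun y : ℝ => h (y, t)) x = fderiv ℝ h (x, t) (1, 0) :=
  ((hh (x, t)).hasFDerivAt.comp_hasDerivAt x
    ((hasDerivAt_id x).prodMk (hasDerivAt_const x t))).deriv

theorem deriv_slice_snd {h : ℝ × ℝ → ℂ} (hh : Differentiable ℝ h) (x t : ℝ) :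
    deriv (fun s : ℝ => h (x, s)) t = fderiv ℝ h (x, t) (0, 1) :=
  ((hh (x, t)).hasFDerivAt.comp_hasDerivAt t
    ((hasDerivAt_const t x).prodMk (hasDerivAt_id t))).deriv

theorem deriv_deriv_comm {h : ℝ × ℝ → ℂ} (hh : ContDiff ℝ ∞ h) (x t : ℝ) :
    deriv (fun s : ℝ => deriv (fun y : ℝ => h (y, s)) x) t
      = deriv (fun y : ℝ => deriv (fun s : ℝ => h (y, s)) t) x := by
  have hd : Differentiable ℝ h := hh.differentiable (by simp)
  have hf : ContDiff ℝ ∞ (fderiv ℝ h) := hh.fderiv_right (by simp)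
  have hfd : Differentiable ℝ (fderiv ℝ h) := hf.differentiable (by simp)
  simp only [deriv_slice_fst hd, deriv_slice_snd hd]
  have ha (v : ℝ × ℝ) : Differentiable ℝ (fun p => fderiv ℝ h p v) :=
    fun p => (hfd p).clm_apply (differentiableAt_const v)
  rw [deriv_slice_snd (ha _) x t, deriv_slice_fst (ha _) x t]
  have e (v w : ℝ × ℝ) :
      fderiv ℝ (fun p => fderiv ℝ h p v) (x, t) w = fderiv ℝ (fderiv ℝ h) (x, t) w v := by
    rw [fderiv_clm_apply (hfd _) (differentiableAt_const v)]
    simp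
  rw [e, e]
  exact second_derivative_symmetric (fun y => (hd y).hasFDerivAt) (hfd _).hasFDerivAt _ _

/-- The equation is invariant under multiplication by a constant phase. -/
theorem IsSolution.const_mul {q : ℝ → ℝ → ℂ} (hq : IsSolution q) {c : ℂ} (hc : ‖c‖ = 1) :
    IsSolution (fun x t => c * q x t) := by
  refine ⟨contDiff_const.mul hq.1, fun x t => ?_⟩
  have e : ∀ y, ((‖c * q y t‖ ^ 2 : ℝ) : ℂ) * (c * q y t)
      = c * (((‖q y t‖ ^ 2 : ℝ) : ℂ) * q y t) := fun y => by
    rw [norm_mul, hc, one_mul]; ring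
  simp only [e, deriv_const_mul_field, iteratedDeriv_const_mul_field]
  linear_combination c * hq.2 x t

/-- A potential `b` with `b_x = q` and `b_t = -i q_x - |q|² q` yields a solution `q`. -/
theorem isSolution_of_potential {q b : ℝ → ℝ → ℂ}
    (hq : ContDiff ℝ ∞ (fun p : ℝ × ℝ => q p.1 p.2))
    (hb : ContDiff ℝ ∞ (fun p : ℝ × ℝ => b p.1 p.2))
    (hx : ∀ x t, deriv (fun y => b y t) x = q x t)
    (ht : ∀ x t, deriv (fun s => b x s) t
      = -I * deriv (fun y => q y t) x - ((‖q x t‖ ^ 2 : ℝ) : ℂ) * q x t) :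
    IsSolution q := by
  refine ⟨hq, fun x t => ?_⟩
  have h1 : deriv (fun s => q x s) t = deriv (fun y => -I * deriv (fun y => q y t) y
      - ((‖q y t‖ ^ 2 : ℝ) : ℂ) * q y t) x := by
    have := deriv_deriv_comm hb x t
    simpa only [hx, ht] using this
  have hs : ContDiff ℝ ∞ (fun y => q y t) := contDiff_slice_fst hq t
  have hs' : ContDiff ℝ ∞ (deriv (fun y => q y t)) := hs.iterate_deriv 1
  have hn : ContDiff ℝ ∞ (fun y => ((‖q y t‖ ^ 2 : ℝ) : ℂ) * q y t) :=
    (ofRealCLM.contDiff.comp (hs.norm_sq ℝ)).mul hs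
  rw [h1, deriv_fun_sub ((hs'.differentiable (by simp) x).const_mul _)
    (hn.differentiable (by simp) x), deriv_const_mul_field, iteratedDeriv_succ, iteratedDeriv_one]
  linear_combination -(deriv (deriv fun y => q y t) x) * I_sq

end Calculus

/-! ### Polynomials as relations between moments -/

section Pairing

open Polynomial

variable {V : Type*} [AddCommGroup V] [Module ℂ V]

/-- The linear map `X ^ j ↦ v j`. -/
noncomputable def pairing (v : ℕ → V) : ℂ[X] →ₗ[ℂ] V :=
  Polynomial.lsum fun j => LinearMap.toSpanSingleton ℂ V (v j)

theorem pairing_eq_sum_range (v : ℕ → V) {p : ℂ[X]} {N : ℕ} (h : p.natDegree < N) :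
    pairing v p = ∑ j ∈ Finset.range N, p.coeff j • v j := by
  rw [pairing, Polynomial.lsum_apply, Polynomial.sum_over_range' _ _ _ h]
  · simp
  · simp

theorem pairing_monomial (v : ℕ → V) (j : ℕ) (c : ℂ) : pairing v (monomial j c) = c • v j := by
  simp [pairing, Polynomial.sum_monomial_index]

/-- The polynomial with coefficients `a 0, …, a d`. -/
noncomputable def polyOf (d : ℕ) (a : ℕ → ℂ) : ℂ[X] :=
  ∑ j ∈ Finset.range (d + 1), monomial j (a j)

theorem pairing_X_pow_mul_polyOf (v : ℕ → V) (m d : ℕ) (a : ℕ → ℂ) :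
    pairing v (X ^ m * polyOf d a) = ∑ j ∈ Finset.range (d + 1), a j • v (j + m) := by
  simp only [polyOf, Finset.mul_sum, map_sum, X_pow_mul_monomial, pairing_monomial]

theorem pairing_polyOf (v : ℕ → V) (d : ℕ) (a : ℕ → ℂ) :
    pairing v (polyOf d a) = ∑ j ∈ Finset.range (d + 1), a j • v j := by
  simp only [polyOf, map_sum, pairing_monomial]

theorem coeff_polyOf {d : ℕ} {a : ℕ → ℂ} (h : ∀ j, d < j → a j = 0) (j : ℕ) :
    (polyOf d a).coeff j = a j := by
  simp only [polyOf, finsetSum_coeff, coeff_monomial, Finset.sum_ite_eq', Finset.mem_range]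
  split_ifs with hj
  · rfl
  · exact (h j (by omega)).symm

end Pairing

end DNLS

/-! ### The Darboux matrix of an abstract system of moments -/

namespace DNLS

/-- The moments of the two components of the vacuum eigenfunction with respect to `2 k` functionals
whose common kernel is stable under multiplication by `z` (`J`) and under conjugation along
`z ↦ -z^*` (`S`). -/
structure WaveSystem (k : ℕ) where
  X : ℕ → ℝ → ℝ → Fin (2 * k) → ℂ
  Y : ℕ → ℝ → ℝ → Fin (2 * k) → ℂ
  J : Matrix (Fin (2 * k)) (Fin (2 * k)) ℂ
  S : Matrix (Fin (2 * k)) (Fin (2 * k)) ℂ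
  mul_Y : ∀ j x t, J.mulVec (Y j x t) = X (j + 1) x t
  mul_X : ∀ j x t, J.mulVec (X j x t) = Y (j + 1) x t
  conj_X : ∀ j x t, star (X j x t) = (-1 : ℂ) ^ j • S.mulVec (Y j x t)
  conj_Y : ∀ j x t, star (Y j x t) = (-1 : ℂ) ^ j • S.mulVec (X j x t)
  smooth_X : ∀ j r, ContDiff ℝ ∞ (fun p : ℝ × ℝ => X j p.1 p.2 r)
  deriv_fst : ∀ j x t r, HasDerivAt (fun y => X j y t r) (I * (-1) ^ j * X (j + 2) x t r) x
  deriv_snd : ∀ j x t r, HasDerivAt (fun s => X j x s r) (2 * I * (-1) ^ j * X (j + 4) x t r) t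
  det_J : J.det ≠ 0
  det_S : ‖S.det‖ = 1

namespace WaveSystem

variable {k : ℕ} (W : WaveSystem k)

noncomputable def det21 (x t : ℝ) : ℂ :=
  Matrix.det (Matrix.of fun r c : Fin (2 * k) => W.Y (2 * k - 1 - (c : ℕ)) x t r)

noncomputable def det11 (x t : ℝ) : ℂ :=
  Matrix.det (Matrix.of fun r c : Fin (2 * k) => W.X (2 * k - 1 - (c : ℕ)) x t r)

noncomputable def det12 (x t : ℝ) : ℂ :=
  Matrix.det (Matrix.of fun r c : Fin (2 * k) =>
    W.X (if (c : ℕ) = 0 then 2 * k else 2 * k - 1 - (c : ℕ)) x t r)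

/-- The matrix of the linear system for the coefficients of the Darboux matrix. -/
noncomputable def coeffMatrix (x t : ℝ) : Matrix (Fin (2 * k)) (Fin (2 * k)) ℂ :=
  Matrix.of fun r c => W.X (2 * k - (c : ℕ)) x t r

/-- Applying `J` to the columns of `det21` gives those of the linear system, so the latter is
solvable exactly where the denominator of q does not vanish. -/
theorem det_coeffMatrix (x t : ℝ) : (W.coeffMatrix x t).det = W.J.det * W.det21 x t := by
  rw [det21, ← Matrix.det_mul]
  congr 1
  ext r c
  have h := congrFun (W.mul_Y (2 * k - 1 - (c : ℕ)) x t) r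
  rw [show 2 * k - 1 - (c : ℕ) + 1 = 2 * k - (c : ℕ) by omega] at h
  simp only [coeffMatrix, Matrix.of_apply, ← h, Matrix.mul_apply, Matrix.mulVec, dotProduct]

theorem conj_det21 : ∃ c : ℂ, ‖c‖ = 1 ∧
    ∀ x t, (starRingEnd ℂ) (W.det21 x t) = c * W.det11 x t := by
  refine ⟨(∏ c : Fin (2 * k), (-1 : ℂ) ^ (2 * k - 1 - (c : ℕ))) * W.S.det, ?_, fun x t => ?_⟩
  · simp [W.det_S, norm_prod]
  · have h : (starRingEnd ℂ) (W.det21 x t) = Matrix.det (Matrix.of fun r c : Fin (2 * k) =>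
        (-1 : ℂ) ^ (2 * k - 1 - (c : ℕ)) *
          (W.S * (Matrix.of fun r c : Fin (2 * k) => W.X (2 * k - 1 - (c : ℕ)) x t r)) r c) := by
      rw [det21, RingHom.map_det]
      congr 1
      ext r c
      have := congrFun (W.conj_Y (2 * k - 1 - (c : ℕ)) x t) r
      simpa [Matrix.mul_apply, Matrix.mulVec, dotProduct] using this
    rw [h, Matrix.det_mul_row, Matrix.det_mul, det11, mul_assoc]

/-- The coefficients of the first row of the Darboux matrix: those of even index belong to its
diagonal entry and those of odd index to its off-diagonal entry. -/
noncomputable def coef (j : ℕ) (x t : ℝ) : ℂ :=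
  if h : 0 < j ∧ j ≤ 2 * k then
    -- Cramer's rule for the unknowns of index 1, ..., 2k, with the normalisation `coef 0 = 1` moved
    -- to the right-hand side. Column c of the system carries X_(2k-c), hence the index `2 * k - j`.
    (W.coeffMatrix x t).cramer (-W.X 0 x t) ⟨2 * k - j, by omega⟩ / (W.coeffMatrix x t).det
  else if j = 0 then 1 else 0

theorem coef_zero (x t : ℝ) : W.coef 0 x t = 1 := by simp [coef]

theorem coef_of_lt {j : ℕ} (hj : 2 * k < j) (x t : ℝ) : W.coef j x t = 0 := by
  rw [coef, dif_neg (by omega), if_neg (by omega)]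

theorem sum_smul_X (a : ℕ → ℂ) (x t : ℝ) :
    ∑ j ∈ Finset.range (2 * k + 1), a j • W.X j x t
      = (W.coeffMatrix x t).mulVec (fun c => a (2 * k - (c : ℕ))) + a 0 • W.X 0 x t := by
  rw [Finset.sum_range_succ', ← Finset.sum_range_reflect, Finset.sum_range]
  congr 1
  ext r
  simp only [Finset.sum_apply, Pi.smul_apply, smul_eq_mul, Matrix.mulVec, dotProduct, coeffMatrix,
    Matrix.of_apply]
  refine Finset.sum_congr rfl fun c _ => ?_
  rw [show 2 * k - 1 - (c : ℕ) + 1 = 2 * k - (c : ℕ) by omega, mul_comm]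

variable {W} in
theorem det_coeffMatrix_ne_zero (h : ∀ x t, W.det21 x t ≠ 0) (x t : ℝ) :
    (W.coeffMatrix x t).det ≠ 0 := by
  rw [det_coeffMatrix]; exact mul_ne_zero W.det_J (h x t)

variable {W} in
theorem sum_coef_smul_X (h : ∀ x t, W.det21 x t ≠ 0) (x t : ℝ) :
    ∑ j ∈ Finset.range (2 * k + 1), W.coef j x t • W.X j x t = 0 := by
  have hM := det_coeffMatrix_ne_zero h x t
  have e : (fun c : Fin (2 * k) => W.coef (2 * k - (c : ℕ)) x t)
      = (W.coeffMatrix x t).det⁻¹ • (W.coeffMatrix x t).cramer (-W.X 0 x t) := by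
    funext c
    rw [coef, dif_pos (by omega), Pi.smul_apply, smul_eq_mul, div_eq_inv_mul]
    simp only [show 2 * k - (2 * k - (c : ℕ)) = (c : ℕ) by omega]
  rw [sum_smul_X, e, Matrix.mulVec_smul, Matrix.mulVec_cramer, smul_smul, inv_mul_cancel₀ hM,
    coef_zero]
  simp

variable {W} in
-- Such a relation involves only the columns of the invertible `coeffMatrix`. This uniqueness
-- converts relations between moments into identities between coefficients.
theorem eq_zero_of_pairing_eq_zero (h : ∀ x t, W.det21 x t ≠ 0) {x t : ℝ} {p : Polynomial ℂ}
    (h0 : p.coeff 0 = 0) (hd : ∀ j, 2 * k < j → p.coeff j = 0)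
    (hp : pairing (fun j => W.X j x t) p = 0) : p = 0 := by
  have hN : p.natDegree < 2 * k + 1 :=
    Nat.lt_succ_of_le (Polynomial.natDegree_le_iff_coeff_eq_zero.2 hd)
  rw [pairing_eq_sum_range _ hN, sum_smul_X, h0, zero_smul, add_zero] at hp
  have := Matrix.eq_zero_of_mulVec_eq_zero (det_coeffMatrix_ne_zero h x t) hp
  ext j
  rcases Nat.eq_zero_or_pos j with rfl | hj
  · simpa using h0
  rcases Nat.lt_or_ge (2 * k) j with hj' | hj'
  · simpa using hd j hj'
  · have := congrFun this ⟨2 * k - j, by omega⟩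
    simpa [show 2 * k - (2 * k - j) = j by omega] using this

theorem contDiff_det {n : ℕ} {A : Fin n → Fin n → ℝ × ℝ → ℂ}
    (hA : ∀ r c, ContDiff ℝ ∞ (A r c)) :
    ContDiff ℝ ∞ (fun p => Matrix.det (Matrix.of fun r c => A r c p)) := by
  simp only [Matrix.det_apply', Matrix.of_apply]
  refine ContDiff.sum fun σ _ => ?_
  have h1 : ContDiff ℝ ∞ (fun p => ∏ i, A (σ i) i p) := contDiff_prod fun i _ => hA _ _
  fun_prop

variable {W} in
theorem contDiff_coef (h : ∀ x t, W.det21 x t ≠ 0) (j : ℕ) :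
    ContDiff ℝ ∞ (fun p : ℝ × ℝ => W.coef j p.1 p.2) := by
  by_cases hj : 0 < j ∧ j ≤ 2 * k
  · simp only [coef, dif_pos hj, div_eq_mul_inv]
    refine ContDiff.mul ?_ (ContDiff.inv ?_ fun p => det_coeffMatrix_ne_zero h _ _)
    · simp only [Matrix.cramer_apply, Matrix.updateCol]
      refine contDiff_det (A := fun r c p => Function.update
        (fun c => W.coeffMatrix p.1 p.2 r c) ⟨2 * k - j, by omega⟩ ((-W.X 0 p.1 p.2) r) c) ?_
      intro r c
      by_cases hc : c = ⟨2 * k - j, by omega⟩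
      · subst hc
        simpa using (W.smooth_X 0 r).neg
      · simpa [Function.update_of_ne hc, coeffMatrix] using W.smooth_X _ r
    · exact contDiff_det (A := fun r c p => W.coeffMatrix p.1 p.2 r c) fun r c => W.smooth_X _ r
  · simp only [coef, dif_neg hj]
    exact contDiff_const

variable {W} in
theorem hasDerivAt_coef_fst (h : ∀ x t, W.det21 x t ≠ 0) (j : ℕ) (x t : ℝ) :
    HasDerivAt (fun y => W.coef j y t) (deriv (fun y => W.coef j y t) x) x :=
  ((contDiff_slice_fst (contDiff_coef h j) t).differentiable (by simp) x).hasDerivAt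

variable {W} in
theorem hasDerivAt_coef_snd (h : ∀ x t, W.det21 x t ≠ 0) (j : ℕ) (x t : ℝ) :
    HasDerivAt (fun s => W.coef j x s) (deriv (fun s => W.coef j x s) t) t :=
  ((contDiff_slice_snd (contDiff_coef h j) x).differentiable (by simp) t).hasDerivAt

theorem X_add_two (j : ℕ) (x t : ℝ) :
    W.X (j + 2) x t = W.J.mulVec (W.J.mulVec (W.X j x t)) := by
  rw [W.mul_X, W.mul_Y]

/-- Relations may be multiplied by z². A single factor z would exchange the families `X` and `Y`. -/
theorem sum_X_add_two {a : ℕ → ℂ} {m d : ℕ} {x t : ℝ}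
    (ha : ∑ j ∈ Finset.range d, a j • W.X (j + m) x t = 0) :
    ∑ j ∈ Finset.range d, a j • W.X (j + (m + 2)) x t = 0 := by
  have e : ∑ j ∈ Finset.range d, a j • W.X (j + (m + 2)) x t
      = W.J.mulVec (W.J.mulVec (∑ j ∈ Finset.range d, a j • W.X (j + m) x t)) := by
    simp only [Matrix.mulVec_sum, Matrix.mulVec_smul, ← X_add_two, ← add_assoc]
  rw [e, ha, Matrix.mulVec_zero, Matrix.mulVec_zero]

variable {W} in
-- This is the second row of the Darboux matrix, multiplied by z: conjugation turns the relation for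
-- `X` into one for `Y`, the invertible `S` is removed, and `J` leads back to `X`.
theorem sum_conj_coef_smul_X (h : ∀ x t, W.det21 x t ≠ 0) (x t : ℝ) :
    ∑ j ∈ Finset.range (2 * k + 1),
      ((-1) ^ j * (starRingEnd ℂ) (W.coef j x t)) • W.X (j + 1) x t = 0 := by
  have h1 := congrArg star (sum_coef_smul_X h x t)
  have hS : W.S.det ≠ 0 := fun h0 => by simpa [h0] using W.det_S
  have h2 : W.S.mulVec (∑ j ∈ Finset.range (2 * k + 1),
      ((-1) ^ j * (starRingEnd ℂ) (W.coef j x t)) • W.Y j x t) = 0 := by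
    rw [star_sum, star_zero] at h1
    rw [← h1, Matrix.mulVec_sum]
    refine Finset.sum_congr rfl fun j _ => ?_
    rw [star_smul, W.conj_X, Matrix.mulVec_smul, smul_smul, starRingEnd_apply,
      mul_comm ((-1 : ℂ) ^ j)]
  have h3 := Matrix.eq_zero_of_mulVec_eq_zero hS h2
  have h4 := congrArg W.J.mulVec h3
  simpa only [Matrix.mulVec_sum, Matrix.mulVec_smul, W.mul_Y, Matrix.mulVec_zero] using h4

open Polynomial

variable {W} in
-- The x-part of the Lax equation for the first row. The number `q` is the multiple of the second
-- row whose subtraction removes the excess degree.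
theorem deriv_coef_fst (hk : 1 ≤ k) (h : ∀ x t, W.det21 x t ≠ 0) (x t : ℝ) {q : ℂ}
    (hq : q * (starRingEnd ℂ) (W.coef (2 * k) x t) = -2 * I * W.coef (2 * k - 1) x t) (j : ℕ) :
    deriv (fun y => W.coef j y t) x
      = I * (if 2 ≤ j then (1 - (-1) ^ (j - 2)) * W.coef (j - 2) x t else 0)
        + q * (if 1 ≤ j then (-1) ^ (j - 1) * (starRingEnd ℂ) (W.coef (j - 1) x t) else 0) := by
  set u' : ℕ → ℂ := fun j => deriv (fun y => W.coef j y t) x with hu'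
  have hv (j : ℕ) (hj : 2 * k < j) : u' j = 0 := by
    simp only [hu', W.coef_of_lt hj, deriv_const]
  have hu0 : u' 0 = 0 := by simp only [hu', coef_zero, deriv_const]
  -- The first two terms are the x-derivative of the defining relation; the others are z² times the
  -- first row and z times the second. In degree 2k + 2 the contributions cancel, in degree 2k + 1
  -- they do so by `hq`, and there is no constant term.
  set w : ℂ[X] := polyOf (2 * k) u' + I • (Polynomial.X ^ 2 * polyOf (2 * k) fun j => (-1) ^ j * W.coef j x t)
    - I • (Polynomial.X ^ 2 * polyOf (2 * k) fun j => W.coef j x t)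
    - q • (Polynomial.X ^ 1 * polyOf (2 * k) fun j => (-1) ^ j * (starRingEnd ℂ) (W.coef j x t)) with hw
  have hc (j : ℕ) : w.coeff j = u' j
      + I * (if 2 ≤ j then (-1) ^ (j - 2) * W.coef (j - 2) x t else 0)
      - I * (if 2 ≤ j then W.coef (j - 2) x t else 0)
      - q * (if 1 ≤ j then (-1) ^ (j - 1) * (starRingEnd ℂ) (W.coef (j - 1) x t) else 0) := by
    simp only [hw, coeff_add, coeff_sub, coeff_smul, smul_eq_mul, coeff_X_pow_mul']
    rw [coeff_polyOf hv, coeff_polyOf, coeff_polyOf, coeff_polyOf]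
    all_goals
      intro i hi
      simp only [W.coef_of_lt hi, map_zero, mul_zero]
  have hw0 : w = 0 := by
    refine eq_zero_of_pairing_eq_zero h (x := x) (t := t) ?_ ?_ ?_
    · rw [hc]; simp [hu0]
    · intro j hj
      rw [hc, hv j hj]
      obtain ⟨i, rfl⟩ := Nat.exists_eq_add_of_lt hj
      rw [if_pos (by omega), if_pos (by omega), if_pos (by omega)]
      rcases i with _ | _ | i
      · have e1 : (-1 : ℂ) ^ (2 * k - 1) = -1 := Odd.neg_one_pow ⟨k - 1, by omega⟩
        have e2 : (-1 : ℂ) ^ (2 * k) = 1 := Even.neg_one_pow ⟨k, by omega⟩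
        rw [show 2 * k + 0 + 1 - 2 = 2 * k - 1 by omega, show 2 * k + 0 + 1 - 1 = 2 * k by omega,
          e1, e2]
        linear_combination -hq
      · have e2 : (-1 : ℂ) ^ (2 * k) = 1 := Even.neg_one_pow ⟨k, by omega⟩
        rw [show 2 * k + (0 + 1) + 1 - 2 = 2 * k by omega,
          W.coef_of_lt (show 2 * k < 2 * k + (0 + 1) + 1 - 1 by omega), e2]
        simp
      · rw [W.coef_of_lt (by omega), W.coef_of_lt (by omega)]
        simp
    · have e1 : ∑ j ∈ Finset.range (2 * k + 1), u' j • W.X j x t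
          + I • ∑ j ∈ Finset.range (2 * k + 1), ((-1) ^ j * W.coef j x t) • W.X (j + 2) x t = 0 := by
        ext r
        have hd := HasDerivAt.fun_sum (u := Finset.range (2 * k + 1)) fun j _ =>
          (hasDerivAt_coef_fst h j x t).mul (W.deriv_fst j x t r)
        have hz : (fun y => ∑ j ∈ Finset.range (2 * k + 1), W.coef j y t * W.X j y t r)
            = fun _ => 0 := by
          funext y
          simpa using congrFun (sum_coef_smul_X h y t) r
        have := hd.unique ((hasDerivAt_const x (0 : ℂ)).congr_of_eventuallyEq
          (Eventually.of_forall fun y => congrFun hz y))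
        refine Eq.trans ?_ this
        simp only [Pi.add_apply, Finset.sum_apply, Pi.smul_apply, smul_eq_mul, Finset.mul_sum,
          ← Finset.sum_add_distrib]
        refine Finset.sum_congr rfl fun j _ => ?_
        simp only [hu']; ring
      have e2 := W.sum_X_add_two (m := 0) (sum_coef_smul_X h x t)
      have e3 := sum_conj_coef_smul_X h x t
      rw [hw]
      simp only [map_add, map_sub, map_smul, pairing_X_pow_mul_polyOf, pairing_polyOf]
      simp only [zero_add] at e2
      rw [e1, e2, e3]
      simp
  have := hc j
  rw [hw0, coeff_zero] at this
  simp only [hu'] at this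
  rw [sub_mul, one_mul]
  split_ifs at this ⊢ <;> linear_combination -this

variable {W} in
-- The t-part, by the same argument with excess degree up to 2k + 4; `v₁`, `v₂` and `q` are the
-- multipliers of the two rows. Only the coefficient of z is read off. The case distinction in `e`
-- is needed because for k = 1 the truncated index 2k - 3 would give `coef 0 = 1` in place of 0.
theorem deriv_coef_one_snd (hk : 1 ≤ k) (h : ∀ x t, W.det21 x t ≠ 0) (x t : ℝ) {q v₁ v₂ e : ℂ}
    (hq : q * (starRingEnd ℂ) (W.coef (2 * k) x t) = -2 * I * W.coef (2 * k - 1) x t)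
    (hv₂ : v₂ * W.coef (2 * k) x t = 2 * q * (starRingEnd ℂ) (W.coef (2 * k - 1) x t))
    (he : e = if 4 ≤ 2 * k + 1 then W.coef (2 * k - 3) x t else 0)
    (hv₁ : v₁ * (starRingEnd ℂ) (W.coef (2 * k) x t) = -4 * I * e - v₂ * W.coef (2 * k - 1) x t
      - 2 * q * (starRingEnd ℂ) (W.coef (2 * k - 2) x t)) :
    deriv (fun s => W.coef 1 x s) t = v₁ := by
  set u' : ℕ → ℂ := fun j => deriv (fun s => W.coef j x s) t with hu'
  have hv (j : ℕ) (hj : 2 * k < j) : u' j = 0 := by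
    simp only [hu', W.coef_of_lt hj, deriv_const]
  have hu0 : u' 0 = 0 := by simp only [hu', coef_zero, deriv_const]
  set w : ℂ[X] := polyOf (2 * k) u'
    + (2 * I) • (Polynomial.X ^ 4 * polyOf (2 * k) fun j => (-1) ^ j * W.coef j x t)
    - (2 * I) • (Polynomial.X ^ 4 * polyOf (2 * k) fun j => W.coef j x t)
    - v₂ • (Polynomial.X ^ 2 * polyOf (2 * k) fun j => W.coef j x t)
    - (2 * q) • (Polynomial.X ^ 3 * polyOf (2 * k) fun j => (-1) ^ j * (starRingEnd ℂ) (W.coef j x t))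
    - v₁ • (Polynomial.X ^ 1 * polyOf (2 * k) fun j => (-1) ^ j * (starRingEnd ℂ) (W.coef j x t)) with hw
  have hc (j : ℕ) : w.coeff j = u' j
      + 2 * I * (if 4 ≤ j then (-1) ^ (j - 4) * W.coef (j - 4) x t else 0)
      - 2 * I * (if 4 ≤ j then W.coef (j - 4) x t else 0)
      - v₂ * (if 2 ≤ j then W.coef (j - 2) x t else 0)
      - 2 * q * (if 3 ≤ j then (-1) ^ (j - 3) * (starRingEnd ℂ) (W.coef (j - 3) x t) else 0)
      - v₁ * (if 1 ≤ j then (-1) ^ (j - 1) * (starRingEnd ℂ) (W.coef (j - 1) x t) else 0) := by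
    simp only [hw, coeff_add, coeff_sub, coeff_smul, smul_eq_mul, coeff_X_pow_mul']
    rw [coeff_polyOf hv, coeff_polyOf, coeff_polyOf, coeff_polyOf, coeff_polyOf,
      coeff_polyOf]
    all_goals
      intro i hi
      simp only [W.coef_of_lt hi, map_zero, mul_zero]
  have hw0 : w = 0 := by
    refine eq_zero_of_pairing_eq_zero h (x := x) (t := t) ?_ ?_ ?_
    · rw [hc]; simp [hu0]
    · intro j hj
      have o1 : (-1 : ℂ) ^ (2 * k - 1) = -1 := Odd.neg_one_pow ⟨k - 1, by omega⟩
      have o2 : (-1 : ℂ) ^ (2 * k) = 1 := Even.neg_one_pow ⟨k, by omega⟩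
      have o3 : (-1 : ℂ) ^ (2 * k - 2) = 1 := Even.neg_one_pow ⟨k - 1, by omega⟩
      rw [hc, hv j hj]
      obtain ⟨i, rfl⟩ := Nat.exists_eq_add_of_lt hj
      -- Degrees 2k + 1, 2k + 2 and 2k + 3 vanish by `hv₁`, `hv₂` and twice `hq`; in degree 2k + 4
      -- the two leading terms cancel by parity, and nothing lies above.
      rcases i with _ | _ | _ | _ | i
      · have e4 : (if 4 ≤ 2 * k + 0 + 1 then
            (-1) ^ (2 * k + 0 + 1 - 4) * W.coef (2 * k + 0 + 1 - 4) x t else 0) = -e := by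
          rw [he]
          simp only [add_zero, show 2 * k + 1 - 4 = 2 * k - 3 by omega]
          split_ifs with h4
          · rw [Odd.neg_one_pow ⟨k - 2, by omega⟩]; ring
          · simp
        have e5 : (if 4 ≤ 2 * k + 0 + 1 then W.coef (2 * k + 0 + 1 - 4) x t else 0) = e := by
          rw [he]; rfl
        rw [e4, e5, if_pos (by omega), if_pos (by omega), if_pos (by omega),
          show 2 * k + 0 + 1 - 2 = 2 * k - 1 by omega, show 2 * k + 0 + 1 - 3 = 2 * k - 2 by omega,
          show 2 * k + 0 + 1 - 1 = 2 * k by omega, o2, o3]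
        linear_combination -hv₁
      · rw [if_pos (by omega), if_pos (by omega), if_pos (by omega), if_pos (by omega),
          if_pos (by omega), show 2 * k + (0 + 1) + 1 - 2 = 2 * k by omega,
          show 2 * k + (0 + 1) + 1 - 3 = 2 * k - 1 by omega,
          show 2 * k + (0 + 1) + 1 - 4 = 2 * k - 2 by omega,
          W.coef_of_lt (show 2 * k < 2 * k + (0 + 1) + 1 - 1 by omega), o1, o3, map_zero]
        linear_combination -hv₂
      · rw [if_pos (by omega), if_pos (by omega), if_pos (by omega), if_pos (by omega),
          if_pos (by omega),
          show 2 * k + (0 + 1 + 1) + 1 - 3 = 2 * k by omega,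
          show 2 * k + (0 + 1 + 1) + 1 - 4 = 2 * k - 1 by omega,
          W.coef_of_lt (show 2 * k < 2 * k + (0 + 1 + 1) + 1 - 1 by omega),
          W.coef_of_lt (show 2 * k < 2 * k + (0 + 1 + 1) + 1 - 2 by omega), o1, o2, map_zero]
        linear_combination -2 * hq
      · rw [if_pos (by omega), if_pos (by omega), if_pos (by omega), if_pos (by omega),
          if_pos (by omega),
          show 2 * k + (0 + 1 + 1 + 1) + 1 - 4 = 2 * k by omega,
          W.coef_of_lt (show 2 * k < 2 * k + (0 + 1 + 1 + 1) + 1 - 1 by omega),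
          W.coef_of_lt (show 2 * k < 2 * k + (0 + 1 + 1 + 1) + 1 - 2 by omega),
          W.coef_of_lt (show 2 * k < 2 * k + (0 + 1 + 1 + 1) + 1 - 3 by omega), o2, map_zero]
        ring
      · rw [W.coef_of_lt (by omega), W.coef_of_lt (by omega), W.coef_of_lt (by omega),
          W.coef_of_lt (by omega)]
        simp
    · have e1 : ∑ j ∈ Finset.range (2 * k + 1), u' j • W.X j x t + (2 * I) •
          ∑ j ∈ Finset.range (2 * k + 1), ((-1) ^ j * W.coef j x t) • W.X (j + 4) x t = 0 := by
        ext r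
        have hd := HasDerivAt.fun_sum (u := Finset.range (2 * k + 1)) fun j _ =>
          (hasDerivAt_coef_snd h j x t).mul (W.deriv_snd j x t r)
        have hz : (fun s => ∑ j ∈ Finset.range (2 * k + 1), W.coef j x s * W.X j x s r)
            = fun _ => 0 := by
          funext s
          simpa using congrFun (sum_coef_smul_X h x s) r
        have := hd.unique ((hasDerivAt_const t (0 : ℂ)).congr_of_eventuallyEq
          (Eventually.of_forall fun y => congrFun hz y))
        refine Eq.trans ?_ this
        simp only [Pi.add_apply, Finset.sum_apply, Pi.smul_apply, smul_eq_mul, Finset.mul_sum,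
          ← Finset.sum_add_distrib]
        refine Finset.sum_congr rfl fun j _ => ?_
        simp only [hu']; ring
      have e2 := W.sum_X_add_two (m := 0) (sum_coef_smul_X h x t)
      have e4 := W.sum_X_add_two e2
      have e3 := sum_conj_coef_smul_X h x t
      have e5 := W.sum_X_add_two e3
      rw [hw]
      simp only [map_add, map_sub, map_smul, pairing_X_pow_mul_polyOf, pairing_polyOf]
      norm_num only at e2 e4 e5
      rw [e1, e2, e3, e4, e5]
      simp
  have := hc 1
  rw [hw0, coeff_zero] at this
  simp [hu', coef_zero] at this
  linear_combination -this

end WaveSystem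

end DNLS

/-! ### From the Darboux coefficients to the determinant formula -/

namespace DNLS

namespace WaveSystem

variable {k : ℕ} {W : WaveSystem k}

theorem coef_eq_det_updateCol (i : Fin (2 * k)) (x t : ℝ) :
    W.coef (2 * k - i) x t
      = -((W.coeffMatrix x t).updateCol i (W.X 0 x t)).det / (W.coeffMatrix x t).det := by
  rw [coef, dif_pos (by omega), map_neg, ← Matrix.cramer_apply]
  simp only [show 2 * k - (2 * k - (i : ℕ)) = (i : ℕ) by omega, Fin.eta, Pi.neg_apply]

theorem norm_sign_eq_one {n : ℕ} (σ : Equiv.Perm (Fin n)) :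
    ‖((Equiv.Perm.sign σ : ℤ) : ℂ)‖ = 1 := by
  rcases Int.units_eq_one_or (Equiv.Perm.sign σ) with h | h <;> simp [h]

/-- In Cramer's rule X_0 replaces the first column X_2k; moving it to the end by a cyclic
permutation gives `det11`. -/
theorem coef_top (hk : 1 ≤ k) : ∃ c : ℂ, ‖c‖ = 1 ∧
    ∀ x t, W.coef (2 * k) x t = c * W.det11 x t / (W.coeffMatrix x t).det := by
  let π : Fin (2 * k) → Fin (2 * k) := fun c =>
    if h : (c : ℕ) = 2 * k - 1 then ⟨0, by omega⟩ else ⟨c + 1, by omega⟩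
  have hπ : Function.Injective π := by
    intro a b hab
    simp only [π] at hab
    split_ifs at hab with h1 h2 h2 <;> simp [Fin.ext_iff] at hab ⊢ <;> omega
  let σ : Equiv.Perm (Fin (2 * k)) := Equiv.ofBijective π (Finite.injective_iff_bijective.1 hπ)
  refine ⟨-((Equiv.Perm.sign σ : ℤ) : ℂ), by rw [norm_neg, norm_sign_eq_one], fun x t => ?_⟩
  have e := coef_eq_det_updateCol (W := W) ⟨0, by omega⟩ x t
  have h11 : W.det11 x t = ((Equiv.Perm.sign σ : ℤ) : ℂ) *
      ((W.coeffMatrix x t).updateCol ⟨0, by omega⟩ (W.X 0 x t)).det := by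
    rw [← Matrix.det_permute', det11]
    congr 1
    ext r c
    simp only [Matrix.of_apply, Matrix.submatrix_apply, id, σ, Equiv.ofBijective_apply, π]
    split_ifs with h
    · simp [h]
    · rw [Matrix.updateCol_ne (by simp [Fin.ext_iff]), coeffMatrix, Matrix.of_apply]
      congr 1
      rw [show 2 * k - 1 - (c : ℕ) = 2 * k - ((c : ℕ) + 1) by omega]
  have hs : ((Equiv.Perm.sign σ : ℤ) : ℂ) * ((Equiv.Perm.sign σ : ℤ) : ℂ) = 1 := by
    rcases Int.units_eq_one_or (Equiv.Perm.sign σ) with h | h <;> simp [h]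
  rw [h11, neg_mul, ← mul_assoc, hs, one_mul, ← e]
  simp

/-- Here X_0 replaces the second column X_(2k-1), and X_2k stays in front, as in `det12`. -/
theorem coef_next (hk : 1 ≤ k) : ∃ c : ℂ, ‖c‖ = 1 ∧
    ∀ x t, W.coef (2 * k - 1) x t = c * W.det12 x t / (W.coeffMatrix x t).det := by
  let π : Fin (2 * k) → Fin (2 * k) := fun c =>
    if (c : ℕ) = 0 then ⟨0, by omega⟩ else
      if h : (c : ℕ) = 2 * k - 1 then ⟨1, by omega⟩ else ⟨c + 1, by omega⟩
  have hπ : Function.Injective π := by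
    intro a b hab
    simp only [π] at hab
    split_ifs at hab <;> simp [Fin.ext_iff] at hab ⊢ <;> omega
  let σ : Equiv.Perm (Fin (2 * k)) := Equiv.ofBijective π (Finite.injective_iff_bijective.1 hπ)
  refine ⟨-((Equiv.Perm.sign σ : ℤ) : ℂ), by rw [norm_neg, norm_sign_eq_one], fun x t => ?_⟩
  have e := coef_eq_det_updateCol (W := W) ⟨1, by omega⟩ x t
  have h12 : W.det12 x t = ((Equiv.Perm.sign σ : ℤ) : ℂ) *
      ((W.coeffMatrix x t).updateCol ⟨1, by omega⟩ (W.X 0 x t)).det := by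
    rw [← Matrix.det_permute', det12]
    congr 1
    ext r c
    simp only [Matrix.of_apply, Matrix.submatrix_apply, id, σ, Equiv.ofBijective_apply, π]
    split_ifs with h h'
    · rw [Matrix.updateCol_ne (by simp [Fin.ext_iff])]; simp [coeffMatrix]
    · simp [h']
    · rw [Matrix.updateCol_ne (by simp [Fin.ext_iff]; omega), coeffMatrix, Matrix.of_apply]
      congr 1
      rw [show 2 * k - 1 - (c : ℕ) = 2 * k - ((c : ℕ) + 1) by omega]
  have hs : ((Equiv.Perm.sign σ : ℤ) : ℂ) * ((Equiv.Perm.sign σ : ℤ) : ℂ) = 1 := by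
    rcases Int.units_eq_one_or (Equiv.Perm.sign σ) with h | h <;> simp [h]
  rw [h12, neg_mul, ← mul_assoc, hs, one_mul, ← e]

theorem det11_ne_zero (h : ∀ x t, W.det21 x t ≠ 0) (x t : ℝ) : W.det11 x t ≠ 0 := by
  obtain ⟨c, -, hc⟩ := W.conj_det21
  intro h0
  have := hc x t
  rw [h0, mul_zero, map_eq_zero] at this
  exact h x t this

theorem coef_top_ne_zero (hk : 1 ≤ k) (h : ∀ x t, W.det21 x t ≠ 0) (x t : ℝ) :
    W.coef (2 * k) x t ≠ 0 := by
  obtain ⟨c, hc, e⟩ := coef_top (W := W) hk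
  rw [e]
  refine div_ne_zero (mul_ne_zero (fun h0 => by simp [h0] at hc) (det11_ne_zero h x t))
    (det_coeffMatrix_ne_zero h x t)

/-- The potential read off from the leading coefficients of the Darboux matrix. -/
noncomputable def potential (W : WaveSystem k) (x t : ℝ) : ℂ :=
  -2 * I * W.coef (2 * k - 1) x t / (starRingEnd ℂ) (W.coef (2 * k) x t)

theorem isSolution_potential (hk : 1 ≤ k) (h : ∀ x t, W.det21 x t ≠ 0) :
    IsSolution W.potential := by
  have hne (x t : ℝ) : (starRingEnd ℂ) (W.coef (2 * k) x t) ≠ 0 :=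
    (map_ne_zero _).2 (coef_top_ne_zero hk h x t)
  have hq (x t : ℝ) : W.potential x t * (starRingEnd ℂ) (W.coef (2 * k) x t)
      = -2 * I * W.coef (2 * k - 1) x t := by
    rw [potential, div_mul_cancel₀ _ (hne x t)]
  have hs : ContDiff ℝ ∞ (fun p : ℝ × ℝ => W.potential p.1 p.2) := by
    simp only [potential, div_eq_mul_inv]
    refine (contDiff_const.mul (contDiff_coef h _)).mul (ContDiff.inv ?_ fun p => hne _ _)
    exact conjCLE.contDiff.comp (contDiff_coef h _)
  -- The coefficient of z serves as the potential b; b_x = q because `coef 0 = 1`.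
  refine isSolution_of_potential hs (contDiff_coef h 1) (fun x t => ?_) fun x t => ?_
  · rw [deriv_coef_fst hk h x t (hq x t)]
    simp [coef_zero]
  · set q := W.potential x t
    set e := if 4 ≤ 2 * k + 1 then W.coef (2 * k - 3) x t else 0 with he
    have hcq : (starRingEnd ℂ) q * W.coef (2 * k) x t
        = 2 * I * (starRingEnd ℂ) (W.coef (2 * k - 1) x t) := by
      have := congrArg (starRingEnd ℂ) (hq x t)
      simpa [q, map_ofNat] using this
    have hn : ((‖q‖ ^ 2 : ℝ) : ℂ) = q * (starRingEnd ℂ) q := by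
      rw [mul_conj']; push_cast; rfl
    have hd : HasDerivAt (fun y => W.potential y t) (deriv (fun y => W.potential y t) x) x :=
      ((contDiff_slice_fst hs t).differentiable (by simp) x).hasDerivAt
    set q' := deriv (fun y => W.potential y t) x
    have o1 : (-1 : ℂ) ^ (2 * k - 1) = -1 := Odd.neg_one_pow ⟨k - 1, by omega⟩
    have o3 : (-1 : ℂ) ^ (2 * k - 2) = 1 := Even.neg_one_pow ⟨k - 1, by omega⟩
    have d1 : deriv (fun y => W.coef (2 * k) y t) x
        = -q * (starRingEnd ℂ) (W.coef (2 * k - 1) x t) := by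
      rw [deriv_coef_fst hk h x t (hq x t), if_pos (by omega), if_pos (by omega), o1, o3]
      ring
    have d2 : deriv (fun y => W.coef (2 * k - 1) y t) x
        = 2 * I * e + q * (starRingEnd ℂ) (W.coef (2 * k - 2) x t) := by
      rw [deriv_coef_fst hk h x t (hq x t), if_pos (show 1 ≤ 2 * k - 1 by omega),
        show 2 * k - 1 - 1 = 2 * k - 2 by omega, o3, he]
      by_cases h2 : 2 ≤ k
      · rw [if_pos (by omega), if_pos (by omega), show 2 * k - 1 - 2 = 2 * k - 3 by omega,
          Odd.neg_one_pow ⟨k - 2, by omega⟩]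
        ring
      · rw [if_neg (by omega), if_neg (by omega)]
        ring
    -- Differentiating the defining equation of q brings q_x into play; with `d1` and `d2` it
    -- becomes the condition on `v₁` required for the t-part.
    have d3 : q' * (starRingEnd ℂ) (W.coef (2 * k) x t)
        + q * (starRingEnd ℂ) (deriv (fun y => W.coef (2 * k) y t) x)
        = -2 * I * deriv (fun y => W.coef (2 * k - 1) y t) x := by
      have a0 : HasDerivAt (fun y => (starRingEnd ℂ) (W.coef (2 * k) y t))
          ((starRingEnd ℂ) (deriv (fun y => W.coef (2 * k) y t) x)) x :=
        (hasDerivAt_coef_fst h (2 * k) x t).star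
      have a1 := hd.mul a0
      have a2 := (hasDerivAt_coef_fst h (2 * k - 1) x t).const_mul (-2 * I)
      refine a1.unique (a2.congr_of_eventuallyEq (Eventually.of_forall fun y => ?_))
      exact hq y t
    rw [d1, d2, map_mul, map_neg, conj_conj] at d3
    have hN := coef_top_ne_zero hk h x t
    refine deriv_coef_one_snd hk h x t (v₂ := -I * (q * (starRingEnd ℂ) q)) (hq x t) ?_ he ?_
    · linear_combination -I * q * hcq - 2 * q * (starRingEnd ℂ) (W.coef (2 * k - 1) x t) * I_sq
    · rw [hn]
      have hb : W.coef (2 * k - 1) x t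
          = I / 2 * (q * (starRingEnd ℂ) (W.coef (2 * k) x t)) := by
        rw [hq]; linear_combination W.coef (2 * k - 1) x t * I_sq
      rw [hb] at d3 ⊢
      linear_combination -I * d3
        + (4 * I * e + 2 * q * (starRingEnd ℂ) (W.coef (2 * k - 2) x t)
          - q ^ 2 * (starRingEnd ℂ) q * (starRingEnd ℂ) (W.coef (2 * k) x t)) * I_sq

/-- The quotient differs from `potential` by a constant of modulus one: permutation signs, the phase
from conjugation, and `J.det` over its conjugate. -/
theorem isSolution (hk : 1 ≤ k) (h : ∀ x t, W.det21 x t ≠ 0) :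
    IsSolution fun x t => 2 * I * (W.det11 x t * W.det12 x t) / W.det21 x t ^ 2 := by
  obtain ⟨c₁, n₁, e₁⟩ := coef_top (W := W) hk
  obtain ⟨c₂, n₂, e₂⟩ := coef_next (W := W) hk
  obtain ⟨c₃, n₃, e₃⟩ := W.conj_det21
  have hc (c : ℂ) (n : ‖c‖ = 1) : c ≠ 0 := fun h0 => by simp [h0] at n
  have hcc (c : ℂ) (n : ‖c‖ = 1) : (starRingEnd ℂ) c = c⁻¹ := by
    rw [inv_def, normSq_eq_norm_sq, n]; simp
  have key (x t : ℝ) : 2 * I * (W.det11 x t * W.det12 x t) / W.det21 x t ^ 2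
      = -(W.J.det * (c₁ * c₂ * (starRingEnd ℂ) W.J.det)⁻¹) * W.potential x t := by
    have h21 := h x t
    have h11 := det11_ne_zero h x t
    have e11 : (starRingEnd ℂ) (W.det11 x t) = c₃ * W.det21 x t := by
      have := congrArg (starRingEnd ℂ) (e₃ x t)
      rw [conj_conj, map_mul, hcc _ n₃] at this
      rw [this, mul_inv_cancel_left₀ (hc _ n₃)]
    have hJ' : (starRingEnd ℂ) W.J.det ≠ 0 := (map_ne_zero _).2 W.det_J
    have hJ := W.det_J
    have := hc _ n₁; have := hc _ n₂; have := hc _ n₃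
    rw [potential, e₁, e₂, det_coeffMatrix]
    simp only [map_div₀, map_mul, e11, e₃, hcc _ n₁]
    field_simp
  simp only [key]
  refine (isSolution_potential hk h).const_mul ?_
  rw [norm_neg, norm_mul, norm_inv, norm_mul, norm_mul, n₁, n₂, norm_conj, one_mul, one_mul,
    mul_inv_cancel₀ (norm_ne_zero_iff.2 W.det_J)]

end WaveSystem

end DNLS

/-! ### Taylor functionals at points symmetric under z ↦ -z^* -/

namespace DNLS

/-- The determinant whose row `r` consists of the Taylor coefficients of order `r / m` at the point
`w (r % m)`. -/
noncomputable def confluentDet (k m : ℕ) (w : ℕ → ℂ) (e : Fin (2 * k) → ℂ → ℂ → ℂ → ℂ)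
    (x t : ℝ) : ℂ :=
  Matrix.det (Matrix.of fun r c : Fin (2 * k) =>
    taylorCoeff (fun z => e c z (vacF x t z) (vacG x t z)) ((r : ℕ) / m) (w ((r : ℕ) % m)))

theorem taylorDet_eq_confluentDet (k : ℕ) (e : Fin (2 * k) → ℂ → ℂ → ℂ → ℂ) (a b : ℂ) (x t : ℝ) :
    taylorDet k e a b x t = confluentDet k 2 (fun i => if i = 0 then a else b) e x t := rfl

theorem neg_one_pow_eq_ite (c k : ℕ) (hc : c < 2 * k) :
    (-1 : ℂ) ^ (2 * k - 1 - c) = if c % 2 = 0 then -1 else 1 := by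
  split_ifs with h
  · exact Odd.neg_one_pow ⟨(2 * k - 1 - c) / 2, by omega⟩
  · exact Even.neg_one_pow ⟨(2 * k - 1 - c) / 2, by omega⟩

theorem entry11_eq (k : ℕ) (c : Fin (2 * k)) (x t : ℝ) (z : ℂ) :
    entry11 k c z (vacF x t z) (vacG x t z)
      = z ^ (2 * k - 1 - (c : ℕ)) * wave (I * (-1) ^ (2 * k - 1 - (c : ℕ))) x t z := by
  rw [entry11, vacF_eq_wave, vacG_eq_wave, neg_one_pow_eq_ite _ _ c.2]
  split_ifs <;> simp

theorem entry21_eq (k : ℕ) (c : Fin (2 * k)) (x t : ℝ) (z : ℂ) :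
    entry21 k c z (vacF x t z) (vacG x t z)
      = z ^ (2 * k - 1 - (c : ℕ)) * wave (-(I * (-1) ^ (2 * k - 1 - (c : ℕ)))) x t z := by
  rw [entry21, vacF_eq_wave, vacG_eq_wave, neg_one_pow_eq_ite _ _ c.2]
  split_ifs <;> simp

theorem entry12_eq (k : ℕ) (c : Fin (2 * k)) (x t : ℝ) (z : ℂ) :
    entry12 k c z (vacF x t z) (vacG x t z)
      = z ^ (if (c : ℕ) = 0 then 2 * k else 2 * k - 1 - (c : ℕ)) *
        wave (I * (-1) ^ (if (c : ℕ) = 0 then 2 * k else 2 * k - 1 - (c : ℕ))) x t z := by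
  rw [entry12]
  split_ifs with h
  · rw [Even.neg_one_pow ⟨k, by omega⟩, mul_one, vacF_eq_wave]
  · exact entry11_eq k c x t z

/-- The row of the reflected point. -/
def reflectRow {n m : ℕ} (hm : 0 < m) (hmn : m ∣ n) (r : Fin n) : Fin n :=
  ⟨m * ((r : ℕ) / m) + (m - 1 - (r : ℕ) % m), by
    obtain ⟨d, rfl⟩ := hmn
    have h1 : (r : ℕ) / m < d := Nat.div_lt_of_lt_mul r.2
    have h2 : m * ((r : ℕ) / m + 1) ≤ m * d := Nat.mul_le_mul_left m h1
    rw [mul_add, mul_one] at h2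
    omega⟩

theorem reflectRow_div {n m : ℕ} (hm : 0 < m) (hmn : m ∣ n) (r : Fin n) :
    (reflectRow hm hmn r : ℕ) / m = (r : ℕ) / m := by
  simp only [reflectRow]
  rw [Nat.mul_add_div hm, Nat.div_eq_of_lt (a := m - 1 - (r : ℕ) % m) (by omega), add_zero]

theorem reflectRow_mod {n m : ℕ} (hm : 0 < m) (hmn : m ∣ n) (r : Fin n) :
    (reflectRow hm hmn r : ℕ) % m = m - 1 - (r : ℕ) % m := by
  simp only [reflectRow]
  rw [Nat.mul_add_mod, Nat.mod_eq_of_lt (by omega)]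

theorem reflectRow_involutive {n m : ℕ} (hm : 0 < m) (hmn : m ∣ n) :
    Function.Involutive (reflectRow hm hmn) := by
  intro r
  apply Fin.ext
  rw [← Nat.div_add_mod (reflectRow hm hmn (reflectRow hm hmn r) : ℕ) m, reflectRow_div,
    reflectRow_div, reflectRow_mod, reflectRow_mod]
  have := Nat.mod_lt (r : ℕ) hm
  have := Nat.div_add_mod (r : ℕ) m
  omega

/-- Points `w 0, …, w (m - 1)`, listed symmetrically with respect to `z ↦ -z^*`, different from
zero. -/
structure SymmetricPoints (k m : ℕ) (w : ℕ → ℂ) : Prop where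
  pos : 0 < m
  dvd : m ∣ 2 * k
  conj : ∀ i < m, -(starRingEnd ℂ) (w i) = w (m - 1 - i)
  ne_zero : ∀ i < m, w i ≠ 0

/-- The moment of `z ^ j * wave s x t z` with respect to the functional of row `r`. -/
noncomputable def moment (m : ℕ) (w : ℕ → ℂ) (s : ℂ) (j : ℕ) (x t : ℝ) (r : ℕ) : ℂ :=
  jet s (r / m) j (w (r % m)) x t / ((r / m).factorial : ℂ)

/-- Multiplication by `z` on the functionals. -/
noncomputable def shiftMatrix (n m : ℕ) (w : ℕ → ℂ) : Matrix (Fin n) (Fin n) ℂ :=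
  Matrix.of fun r s => if s = r then w ((r : ℕ) % m) else if (s : ℕ) + m = r then 1 else 0

/-- Conjugation along `z ↦ -z^*` on the functionals. -/
noncomputable def reflectMatrix {n m : ℕ} (hm : 0 < m) (hmn : m ∣ n) : Matrix (Fin n) (Fin n) ℂ :=
  Matrix.of fun r s => (-1) ^ ((r : ℕ) / m) *
    (1 : Matrix (Fin n) (Fin n) ℂ).submatrix (reflectRow_involutive hm hmn).toPerm id r s

/-- Leibniz' rule for Taylor coefficients: that of zF of order l at a is a times that of F plus the
one of order l - 1, which sits m rows higher at the same point. -/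
theorem shiftMatrix_mulVec {n m : ℕ} (hm : 0 < m) (w : ℕ → ℂ) (s : ℂ) (j : ℕ) (x t : ℝ) :
    (shiftMatrix n m w).mulVec (fun r => moment m w s j x t r)
      = fun r : Fin n => moment m w s (j + 1) x t r := by
  funext r
  have e : (shiftMatrix n m w).mulVec (fun r => moment m w s j x t r) r
      = w ((r : ℕ) % m) * moment m w s j x t r
        + if m ≤ (r : ℕ) then moment m w s j x t ((r : ℕ) - m) else 0 := by
    have hsplit (q : Fin n) : shiftMatrix n m w r q * moment m w s j x t q
        = (if q = r then w ((r : ℕ) % m) * moment m w s j x t r else 0)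
          + if (q : ℕ) + m = r then moment m w s j x t q else 0 := by
      simp only [shiftMatrix, Matrix.of_apply]
      split_ifs with h1 h2 h2
      · subst h1; omega
      · subst h1; ring
      · ring
      · ring
    rw [Matrix.mulVec, dotProduct, Finset.sum_congr rfl fun q _ => hsplit q,
      Finset.sum_add_distrib, Finset.sum_ite_eq' _ r, if_pos (Finset.mem_univ _)]
    congr 1
    split_ifs with h
    · rw [Finset.sum_eq_single_of_mem (⟨(r : ℕ) - m, by omega⟩ : Fin n) (Finset.mem_univ _)]
      · simp [h]
      · intro q _ hq
        rw [if_neg]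
        intro h'
        exact hq (Fin.ext (by simp only []; omega))
    · exact Finset.sum_eq_zero fun q _ => if_neg (by omega)
  rw [e]
  simp only [moment]
  rw [jet_mul_id]
  split_ifs with h
  · obtain ⟨i, hi⟩ := Nat.exists_eq_add_of_le' h
    rw [hi, Nat.add_sub_cancel, Nat.add_mod_right, Nat.add_div_right _ hm,
      Nat.add_sub_cancel, Nat.factorial_succ]
    have h1 : ((i / m).factorial : ℂ) ≠ 0 := by exact_mod_cast (i / m).factorial_ne_zero
    have h2 : ((i / m : ℕ) : ℂ) + 1 ≠ 0 := Nat.cast_add_one_ne_zero _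
    push_cast
    field_simp
  · rw [Nat.div_eq_of_lt (by omega)]
    simp

theorem det_shiftMatrix {n m : ℕ} (hm : 0 < m) (w : ℕ → ℂ) :
    (shiftMatrix n m w).det = ∏ r : Fin n, w ((r : ℕ) % m) := by
  rw [Matrix.det_of_isLowerTriangular]
  · simp [shiftMatrix]
  · intro i j hij
    have hij : i < j := hij
    simp only [shiftMatrix, Matrix.of_apply]
    rw [if_neg (by omega), if_neg (by omega)]

theorem norm_det_reflectMatrix {n m : ℕ} (hm : 0 < m) (hmn : m ∣ n) :
    ‖(reflectMatrix hm hmn).det‖ = 1 := by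
  rw [reflectMatrix, Matrix.det_mul_column, Matrix.det_permute, Matrix.det_one, norm_mul, norm_mul,
    WaveSystem.norm_sign_eq_one]
  simp [norm_prod]

variable {k m : ℕ} {w : ℕ → ℂ}

/-- Reflection preserves the order l and exchanges point i with point m - 1 - i. Of the sign in
`conj_jet`, the part depending on l is absorbed into `reflectMatrix`. -/
theorem SymmetricPoints.conj_moment (h : SymmetricPoints k m w) {s s' : ℂ}
    (hs : (starRingEnd ℂ) s = s') (j : ℕ) (x t : ℝ) :
    star (fun r : Fin (2 * k) => moment m w s j x t r)
      = (-1 : ℂ) ^ j • (reflectMatrix h.pos h.dvd).mulVec (fun r => moment m w s' j x t r) := by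
  funext r
  have e : (reflectMatrix h.pos h.dvd).mulVec (fun r => moment m w s' j x t r) r
      = (-1) ^ ((r : ℕ) / m) * moment m w s' j x t (reflectRow h.pos h.dvd r) := by
    simp only [reflectMatrix, Matrix.mulVec, dotProduct, Matrix.of_apply, Matrix.submatrix_apply,
      Function.Involutive.coe_toPerm, id, Matrix.one_apply, mul_ite, mul_one, mul_zero, ite_mul,
      zero_mul, Finset.sum_ite_eq, Finset.mem_univ, if_true]
  rw [Pi.smul_apply, e, Pi.star_apply]
  simp only [moment, reflectRow_div, reflectRow_mod, ← h.conj _ (Nat.mod_lt _ h.pos)]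
  rw [← starRingEnd_apply, map_div₀, conj_jet, hs, map_natCast, pow_add, smul_eq_mul]
  ring

/-- The moments of the vacuum eigenfunction at symmetric points. -/
noncomputable def SymmetricPoints.waveSystem (h : SymmetricPoints k m w) : WaveSystem k where
  X j x t r := moment m w (I * (-1) ^ j) j x t r
  Y j x t r := moment m w (-(I * (-1) ^ j)) j x t r
  J := shiftMatrix _ m w
  S := reflectMatrix h.pos h.dvd
  mul_Y j x t := by
    rw [shiftMatrix_mulVec h.pos, pow_succ, mul_neg_one, mul_neg]
  mul_X j x t := by
    rw [shiftMatrix_mulVec h.pos, pow_succ, mul_neg_one, mul_neg, neg_neg]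
  conj_X j x t := h.conj_moment (by simp) j x t
  conj_Y j x t := h.conj_moment (by simp) j x t
  smooth_X j r := by
    simp only [moment, div_eq_mul_inv]
    exact (contDiff_jet _ _ _ _).mul contDiff_const
  deriv_fst j x t r := by
    simp only [moment]
    refine ((hasDerivAt_jet_fst _ _ _ _ _ _).div_const _).congr_deriv ?_
    rw [pow_add, neg_one_sq, mul_one, mul_div_assoc]
  deriv_snd j x t r := by
    simp only [moment]
    refine ((hasDerivAt_jet_snd _ _ _ _ _ _).div_const _).congr_deriv ?_
    rw [pow_add, Even.neg_one_pow (show Even 4 by decide), mul_one]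
    ring
  det_J := by
    rw [det_shiftMatrix h.pos]
    exact Finset.prod_ne_zero_iff.2 fun r _ => h.ne_zero _ (Nat.mod_lt _ h.pos)
  det_S := norm_det_reflectMatrix h.pos h.dvd

theorem SymmetricPoints.det21_eq (h : SymmetricPoints k m w) (x t : ℝ) :
    h.waveSystem.det21 x t = confluentDet k m w (entry21 k) x t := by
  simp only [confluentDet, entry21_eq]; rfl

theorem SymmetricPoints.det11_eq (h : SymmetricPoints k m w) (x t : ℝ) :
    h.waveSystem.det11 x t = confluentDet k m w (entry11 k) x t := by
  simp only [confluentDet, entry11_eq]; rfl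

theorem SymmetricPoints.det12_eq (h : SymmetricPoints k m w) (x t : ℝ) :
    h.waveSystem.det12 x t = confluentDet k m w (entry12 k) x t := by
  simp only [confluentDet, entry12_eq]; rfl

theorem SymmetricPoints.isSolution (h : SymmetricPoints k m w) (hk : 1 ≤ k)
    (hd : ∀ x t, confluentDet k m w (entry21 k) x t ≠ 0) :
    IsSolution fun x t => 2 * I * (confluentDet k m w (entry11 k) x t *
      confluentDet k m w (entry12 k) x t) / confluentDet k m w (entry21 k) x t ^ 2 := by
  simp only [← h.det21_eq, ← h.det11_eq, ← h.det12_eq] at hd ⊢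
  exact WaveSystem.isSolution hk hd

end DNLS

namespace DNLS

/-! ### Counting zeros of polynomials and parity -/

section Vanishing

open Polynomial

theorem analyticAt_eval (p : ℂ[X]) (a : ℂ) : AnalyticAt ℂ (fun z => p.eval z) a :=
  p.differentiable.analyticAt a

theorem dvd_of_le_analyticOrderAt {p : ℂ[X]} {a : ℂ} {n : ℕ}
    (h : n ≤ analyticOrderAt (fun z => p.eval z) a) : (X - C a) ^ n ∣ p := by
  rcases eq_or_ne p 0 with rfl | hp
  · exact dvd_zero _
  obtain ⟨q, hq, hdvd⟩ := exists_eq_pow_rootMultiplicity_mul_and_not_dvd p hp a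
  have ho : analyticOrderAt (fun z => p.eval z) a = (p.rootMultiplicity a : ℕ) := by
    rw [(analyticAt_eval p a).analyticOrderAt_eq_natCast]
    refine ⟨fun z => q.eval z, analyticAt_eval q a, fun h0 => hdvd (dvd_iff_isRoot.2 h0),
      Eventually.of_forall fun z => ?_⟩
    conv_lhs => rw [hq]
    simp
  rw [ho] at h
  rw [hq]
  exact (pow_dvd_pow _ (by exact_mod_cast h)).trans (dvd_mul_right _ _)

theorem dvd_of_le_analyticOrderAt_mul {p : ℂ[X]} {a : ℂ} {n : ℕ} {f : ℂ → ℂ}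
    (hf : AnalyticAt ℂ f a) (hfa : f a ≠ 0)
    (h : n ≤ analyticOrderAt (fun z => p.eval z * f z) a) : (X - C a) ^ n ∣ p := by
  apply dvd_of_le_analyticOrderAt
  have := analyticOrderAt_mul (analyticAt_eval p a) hf
  rw [hf.analyticOrderAt_eq_zero.2 hfa, add_zero] at this
  rwa [← this]

theorem le_analyticOrderAt_eval_mul {p : ℂ[X]} {a : ℂ} {n : ℕ} {f : ℂ → ℂ}
    (hf : AnalyticAt ℂ f a) (h : n ≤ analyticOrderAt f a) :
    n ≤ analyticOrderAt (fun z => p.eval z * f z) a := by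
  have := analyticOrderAt_mul (analyticAt_eval p a) hf
  exact (h.trans le_add_self).trans this.ge

theorem eq_zero_of_forall_pow_dvd {p : ℂ[X]} {T : Finset ℂ} {n : ℕ}
    (h : ∀ a ∈ T, (X - C a) ^ n ∣ p) (hd : p.natDegree < T.card * n) : p = 0 := by
  by_contra hp
  have h1 : ∏ a ∈ T, (X - C a) ^ n ∣ p :=
    Finset.prod_dvd_of_coprime (fun a _ b _ hab =>
      (isCoprime_X_sub_C_of_isUnit_sub (sub_ne_zero_of_ne hab).isUnit).pow) h
  have h2 := natDegree_le_of_dvd h1 hp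
  rw [natDegree_prod_of_monic _ _ fun a _ => (monic_X_sub_C a).pow n] at h2
  simp only [natDegree_pow, natDegree_X_sub_C, mul_one, Finset.sum_const, smul_eq_mul] at h2
  omega

theorem eval_map_conj_ofReal (p : ℂ[X]) (x : ℝ) :
    (p.map (starRingEnd ℂ)).eval (x : ℂ) = (starRingEnd ℂ) (p.eval (x : ℂ)) := by
  rw [← eval₂_at_apply, conj_ofReal, eval_map]

/-- At real arguments the sum is |a|² + |b|², so both polynomials vanish on the whole real line. -/
theorem eq_zero_of_mul_conj_add_mul_conj {a b : ℂ[X]}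
    (h : a * a.map (starRingEnd ℂ) + b * b.map (starRingEnd ℂ) = 0) : a = 0 ∧ b = 0 := by
  have key (x : ℝ) : a.eval (x : ℂ) = 0 ∧ b.eval (x : ℂ) = 0 := by
    have h1 := congrArg (eval (x : ℂ)) h
    simp only [eval_add, eval_mul, eval_map_conj_ofReal, eval_zero, mul_conj] at h1
    have h2 : normSq (a.eval (x : ℂ)) + normSq (b.eval (x : ℂ)) = 0 := by exact_mod_cast h1
    have := normSq_nonneg (a.eval (x : ℂ))
    have := normSq_nonneg (b.eval (x : ℂ))
    exact ⟨normSq_eq_zero.1 (by linarith), normSq_eq_zero.1 (by linarith)⟩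
  have hinf : (Set.range ((↑) : ℝ → ℂ)).Infinite := Set.infinite_range_of_injective ofReal_injective
  exact ⟨eq_zero_of_infinite_isRoot a (hinf.mono (by rintro _ ⟨x, rfl⟩; exact (key x).1)),
    eq_zero_of_infinite_isRoot b (hinf.mono (by rintro _ ⟨x, rfl⟩; exact (key x).2))⟩

/-- The part with exponents of parity `s` of the polynomial with coefficients
`u 0, …, u (n - 1)`, in decreasing order. -/
noncomputable def parityPart {n : ℕ} (s : ℕ) (u : Fin n → ℂ) : ℂ[X] :=
  ∑ c : Fin n, monomial (n - 1 - (c : ℕ)) (if (n - 1 - (c : ℕ)) % 2 = s then u c else 0)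

theorem coeff_parityPart {n : ℕ} (s : ℕ) (u : Fin n → ℂ) (c : Fin n) :
    (parityPart s u).coeff (n - 1 - (c : ℕ)) = if (n - 1 - (c : ℕ)) % 2 = s then u c else 0 := by
  simp only [parityPart, finsetSum_coeff, coeff_monomial]
  rw [Finset.sum_eq_single_of_mem c (Finset.mem_univ _), if_pos rfl]
  intro b _ hb
  rw [if_neg]
  intro h
  exact hb (Fin.ext (by omega))

theorem natDegree_parityPart {n : ℕ} (s : ℕ) (u : Fin n → ℂ) :
    (parityPart s u).natDegree ≤ n - 1 :=
  natDegree_sum_le_of_forall_le _ _ fun _ _ => (natDegree_monomial_le _).trans (by omega)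

theorem eval_parityPart {n : ℕ} (s : ℕ) (u : Fin n → ℂ) (z : ℂ) :
    (parityPart s u).eval z
      = ∑ c : Fin n, if (n - 1 - (c : ℕ)) % 2 = s then u c * z ^ (n - 1 - (c : ℕ)) else 0 := by
  simp [parityPart, eval_finsetSum, ite_mul]

theorem map_conj_parityPart {n : ℕ} (s : ℕ) (u : Fin n → ℂ) :
    (parityPart s u).map (starRingEnd ℂ) = parityPart s (fun c => (starRingEnd ℂ) (u c)) := by
  simp only [parityPart, Polynomial.map_sum, map_monomial, apply_ite (starRingEnd ℂ), map_zero]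

theorem eval_neg_parityPart_zero {n : ℕ} (u : Fin n → ℂ) (z : ℂ) :
    (parityPart 0 u).eval (-z) = (parityPart 0 u).eval z := by
  simp only [eval_parityPart]
  refine Finset.sum_congr rfl fun c _ => ?_
  split_ifs with h
  · rw [Even.neg_pow (Nat.even_iff.2 h)]
  · rfl

theorem eval_neg_parityPart_one {n : ℕ} (u : Fin n → ℂ) (z : ℂ) :
    (parityPart 1 u).eval (-z) = -(parityPart 1 u).eval z := by
  simp only [eval_parityPart, ← Finset.sum_neg_distrib]
  refine Finset.sum_congr rfl fun c _ => ?_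
  split_ifs with h
  · rw [Odd.neg_pow (Nat.odd_iff.2 h), mul_neg]
  · rw [neg_zero]

theorem le_analyticOrderAt_comp_neg {h : ℂ → ℂ} (hh : Differentiable ℂ h) {n : ℕ} {a : ℂ}
    (ho : n ≤ analyticOrderAt h a) : n ≤ analyticOrderAt (fun z => h (-z)) (-a) := by
  have hd : Differentiable ℂ (fun z => h (-z)) := hh.comp differentiable_neg
  rw [natCast_le_analyticOrderAt_iff_iteratedDeriv_eq_zero (hh.analyticAt _)] at ho
  rw [natCast_le_analyticOrderAt_iff_iteratedDeriv_eq_zero (hd.analyticAt _)]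
  intro i hi
  rw [iteratedDeriv_comp_neg, neg_neg, ho i hi, smul_zero]

end Vanishing

/-! ### Nonvanishing of the denominator -/

section Combination

variable {k m : ℕ} {w : ℕ → ℂ}

theorem wave_neg (s : ℂ) (x t : ℝ) (z : ℂ) : wave s x t (-z) = wave s x t z := by
  simp only [wave, Even.neg_pow (show Even 2 by decide), Even.neg_pow (show Even 4 by decide)]

theorem sum_eq_parityPart (u : Fin (2 * k) → ℂ) (s : ℂ) (x t : ℝ) (z : ℂ) :
    ∑ c : Fin (2 * k), u c * (z ^ (2 * k - 1 - (c : ℕ)) *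
        wave (s * (-1) ^ (2 * k - 1 - (c : ℕ))) x t z)
      = (parityPart 1 u).eval z * wave (-s) x t z + (parityPart 0 u).eval z * wave s x t z := by
  rw [eval_parityPart, eval_parityPart, Finset.sum_mul, Finset.sum_mul, ← Finset.sum_add_distrib]
  refine Finset.sum_congr rfl fun c _ => ?_
  rcases Nat.mod_two_eq_zero_or_one (2 * k - 1 - (c : ℕ)) with h | h
  · rw [if_neg (by omega), if_pos h, Even.neg_one_pow (Nat.even_iff.2 h), mul_one]
    ring
  · rw [if_pos h, if_neg (by omega), Odd.neg_one_pow (Nat.odd_iff.2 h), mul_neg_one]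
    ring

theorem iteratedDeriv_sum_wave (u : Fin (2 * k) → ℂ) (s : ℂ) (x t : ℝ) (l : ℕ) (a : ℂ) :
    iteratedDeriv l (fun z => ∑ c : Fin (2 * k), u c * (z ^ (2 * k - 1 - (c : ℕ)) *
        wave (s * (-1) ^ (2 * k - 1 - (c : ℕ))) x t z)) a
      = ∑ c : Fin (2 * k), u c * jet (s * (-1) ^ (2 * k - 1 - (c : ℕ))) l
          (2 * k - 1 - (c : ℕ)) a x t := by
  rw [iteratedDeriv_fun_sum fun c _ =>
    contDiffAt_const.mul (contDiff_pow_mul_wave _ _ x t).contDiffAt]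
  simp only [iteratedDeriv_const_mul_field, jet]

theorem differentiable_sum_wave (u : Fin (2 * k) → ℂ) (s : ℂ) (x t : ℝ) :
    Differentiable ℂ (fun z => ∑ c : Fin (2 * k), u c * (z ^ (2 * k - 1 - (c : ℕ)) *
        wave (s * (-1) ^ (2 * k - 1 - (c : ℕ))) x t z)) :=
  Differentiable.fun_sum fun c _ =>
    ((contDiff_pow_mul_wave _ _ x t (n := 1)).differentiable (by simp)).const_mul (u c)

/-- A nontrivial relation between the columns of the denominator yields polynomials `a`, odd, and
`b`, even, such that `a f + b g` and its conjugate `b^* f - a^* g` vanish at all points. -/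
theorem SymmetricPoints.exists_of_confluentDet_eq_zero (h : SymmetricPoints k m w) {κ : ℕ}
    (hκ : m * κ = 2 * k) {x t : ℝ} (h0 : confluentDet k m w (entry21 k) x t = 0) :
    ∃ u : Fin (2 * k) → ℂ, u ≠ 0 ∧ ∀ i < m,
      κ ≤ analyticOrderAt (fun z => (parityPart 1 u).eval z * wave I x t z
        + (parityPart 0 u).eval z * wave (-I) x t z) (w i) ∧
      κ ≤ analyticOrderAt (fun z =>
        ((parityPart 0 u).map (starRingEnd ℂ)).eval z * wave I x t z
        - ((parityPart 1 u).map (starRingEnd ℂ)).eval z * wave (-I) x t z) (w i) := by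
  obtain ⟨u, hu, hM⟩ := Matrix.exists_mulVec_eq_zero_iff.2 h0
  have hj (l : ℕ) (hl : l < κ) (i : ℕ) (hi : i < m) :
      ∑ c : Fin (2 * k), u c * jet ((-I) * (-1) ^ (2 * k - 1 - (c : ℕ))) l
        (2 * k - 1 - (c : ℕ)) (w i) x t = 0 := by
    have hr : m * l + i < 2 * k := by
      have : m * (l + 1) ≤ m * κ := Nat.mul_le_mul_left m hl
      rw [mul_add, mul_one] at this
      omega
    have h1 := congrFun hM ⟨m * l + i, hr⟩
    simp only [Matrix.mulVec, dotProduct, Matrix.of_apply, entry21_eq, Pi.zero_apply, taylorCoeff,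
      Nat.mul_add_div h.pos, Nat.div_eq_of_lt hi, add_zero, Nat.mul_add_mod,
      Nat.mod_eq_of_lt hi] at h1
    have h2 : (l.factorial : ℂ) ≠ 0 := by exact_mod_cast l.factorial_ne_zero
    rw [← mul_eq_zero_iff_left (inv_ne_zero h2), ← h1, Finset.mul_sum]
    refine Finset.sum_congr rfl fun c _ => ?_
    rw [jet, neg_mul, div_eq_mul_inv]
    ring
  refine ⟨u, hu, fun i hi => ⟨?_, ?_⟩⟩
  · have e := fun z => sum_eq_parityPart u (-I) x t z
    simp only [neg_neg] at e
    simp only [← e]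
    rw [natCast_le_analyticOrderAt_iff_iteratedDeriv_eq_zero
      ((differentiable_sum_wave _ _ _ _).analyticAt _)]
    intro l hl
    rw [iteratedDeriv_sum_wave]
    exact hj l hl i hi
  -- The signs make the even part of `v` equal to b^* and its odd part equal to -a^*, so the second
  -- function is again a column combination. Its derivatives at `w i` are, up to sign, the
  -- conjugates of those of the first function at the reflected point.
  · set v : Fin (2 * k) → ℂ :=
      fun c => (-1) ^ (2 * k - 1 - (c : ℕ)) * (starRingEnd ℂ) (u c) with hv
    have e0 : (parityPart 0 u).map (starRingEnd ℂ) = parityPart 0 v := by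
      rw [map_conj_parityPart]
      simp only [parityPart]
      refine Finset.sum_congr rfl fun c _ => ?_
      split_ifs with hc
      · simp [hv, Even.neg_one_pow (Nat.even_iff.2 hc)]
      · rfl
    have e1 : (parityPart 1 u).map (starRingEnd ℂ) = -parityPart 1 v := by
      rw [map_conj_parityPart]
      simp only [parityPart, ← Finset.sum_neg_distrib]
      refine Finset.sum_congr rfl fun c _ => ?_
      split_ifs with hc
      · simp [hv, Odd.neg_one_pow (Nat.odd_iff.2 hc)]
      · simp
    have e (z : ℂ) : ((parityPart 0 u).map (starRingEnd ℂ)).eval z * wave I x t z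
        - ((parityPart 1 u).map (starRingEnd ℂ)).eval z * wave (-I) x t z
        = ∑ c : Fin (2 * k), v c * (z ^ (2 * k - 1 - (c : ℕ)) *
        wave (I * (-1) ^ (2 * k - 1 - (c : ℕ))) x t z) := by
      rw [sum_eq_parityPart, e0, e1, Polynomial.eval_neg]
      ring
    simp only [e]
    rw [natCast_le_analyticOrderAt_iff_iteratedDeriv_eq_zero
      ((differentiable_sum_wave _ _ _ _).analyticAt _)]
    intro l hl
    rw [iteratedDeriv_sum_wave]
    have hi' : m - 1 - i < m := by omega
    have hw : w i = -(starRingEnd ℂ) (w (m - 1 - i)) := by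
      rw [h.conj _ hi']; congr 1; omega
    have h1 := congrArg (starRingEnd ℂ) (hj l hl (m - 1 - i) hi')
    rw [map_sum, map_zero] at h1
    have h2 : (-1 : ℂ) ^ l ≠ 0 := pow_ne_zero _ (by norm_num)
    rw [← mul_eq_zero_iff_left h2, ← h1, Finset.mul_sum]
    refine Finset.sum_congr rfl fun c _ => ?_
    rw [map_mul, conj_jet, ← hw]
    simp only [hv, map_mul, map_neg, conj_I, neg_neg, map_pow, map_one, pow_add]
    ring

theorem differentiable_wave (s : ℂ) (x t : ℝ) : Differentiable ℂ (wave s x t) :=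
  (contDiff_wave s x t (n := 1)).differentiable (by simp)

theorem differentiable_eval_mul_wave (p : Polynomial ℂ) (s : ℂ) (x t : ℝ) :
    Differentiable ℂ (fun z => p.eval z * wave s x t z) :=
  p.differentiable.mul (differentiable_wave s x t)

theorem wave_ne_zero (s : ℂ) (x t : ℝ) (z : ℂ) : wave s x t z ≠ 0 := exp_ne_zero _

theorem eq_zero_of_parityPart_eq_zero {n : ℕ} {u : Fin n → ℂ} (h1 : parityPart 1 u = 0)
    (h0 : parityPart 0 u = 0) : u = 0 := by
  funext c
  have e1 := coeff_parityPart 1 u c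
  have e0 := coeff_parityPart 0 u c
  rw [h1, Polynomial.coeff_zero] at e1
  rw [h0, Polynomial.coeff_zero] at e0
  rcases Nat.mod_two_eq_zero_or_one (n - 1 - (c : ℕ)) with h | h
  · rw [if_pos h] at e0; exact e0.symm
  · rw [if_pos h] at e1; exact e1.symm

/-- The denominator has no zero if no two points are opposite to each other. -/
theorem SymmetricPoints.confluentDet_ne_zero (h : SymmetricPoints k m w) (hk : 1 ≤ k)
    (hinj : Set.InjOn w (Finset.range m)) (hopp : ∀ i < m, ∀ j < m, w i ≠ -w j) (x t : ℝ) :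
    confluentDet k m w (entry21 k) x t ≠ 0 := by
  intro h0
  obtain ⟨κ, hκ⟩ := h.dvd
  obtain ⟨u, hu, hv⟩ := h.exists_of_confluentDet_eq_zero hκ.symm h0
  set a := parityPart 1 u with ha
  set b := parityPart 0 u with hb
  set N := a * a.map (starRingEnd ℂ) + b * b.map (starRingEnd ℂ) with hN
  have hNf (i : ℕ) (hi : i < m) : κ ≤ analyticOrderAt (fun z => N.eval z * wave I x t z) (w i) := by
    obtain ⟨v1, v2⟩ := hv i hi
    have d1 := ((differentiable_eval_mul_wave a I x t).fun_add
      (differentiable_eval_mul_wave b (-I) x t)).analyticAt (w i)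
    have d2 := ((differentiable_eval_mul_wave (b.map (starRingEnd ℂ)) I x t).fun_sub
      (differentiable_eval_mul_wave (a.map (starRingEnd ℂ)) (-I) x t)).analyticAt (w i)
    have w1 := le_analyticOrderAt_eval_mul (p := a.map (starRingEnd ℂ)) d1 v1
    have w2 := le_analyticOrderAt_eval_mul (p := b) d2 v2
    -- The terms with g cancel: a^*(af + bg) + b(b^*f - a^*g) = (aa^* + bb^*)f.
    refine (le_min w1 w2).trans (le_analyticOrderAt_add.trans_eq ?_)
    congr 1
    funext z
    simp only [Pi.add_apply, hN, Polynomial.eval_add, Polynomial.eval_mul]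
    ring
  have hNe (z : ℂ) : N.eval (-z) = N.eval z := by
    simp only [hN, ha, hb, map_conj_parityPart, Polynomial.eval_add, Polynomial.eval_mul,
      eval_neg_parityPart_zero, eval_neg_parityPart_one]
    ring
  have hd1 (i : ℕ) (hi : i < m) : (Polynomial.X - Polynomial.C (w i)) ^ κ ∣ N :=
    dvd_of_le_analyticOrderAt_mul ((differentiable_wave I x t).analyticAt _)
      (wave_ne_zero _ _ _ _) (hNf i hi)
  have hd2 (i : ℕ) (hi : i < m) : (Polynomial.X - Polynomial.C (-w i)) ^ κ ∣ N := by
    refine dvd_of_le_analyticOrderAt_mul ((differentiable_wave I x t).analyticAt _)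
      (wave_ne_zero _ _ _ _) ?_
    have := le_analyticOrderAt_comp_neg (differentiable_eval_mul_wave N I x t) (hNf i hi)
    simpa only [hNe, wave_neg] using this
  have hN0 : N = 0 := by
    classical
    -- As N is even it also vanishes at the opposite points. The 2m distinct points of multiplicity
    -- κ give 4k zeros, against degree at most 4k - 2.
    refine eq_zero_of_forall_pow_dvd (n := κ)
      (T := (Finset.range m).image w ∪ (Finset.range m).image fun i => -w i) ?_ ?_
    · intro z hz
      rcases Finset.mem_union.1 hz with hz | hz
      · obtain ⟨i, hi, rfl⟩ := Finset.mem_image.1 hz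
        exact hd1 i (Finset.mem_range.1 hi)
      · obtain ⟨i, hi, rfl⟩ := Finset.mem_image.1 hz
        exact hd2 i (Finset.mem_range.1 hi)
    · rw [Finset.card_union_of_disjoint, Finset.card_image_of_injOn hinj,
        Finset.card_image_of_injOn fun i hi j hj hij => hinj hi hj (neg_injective hij),
        Finset.card_range]
      · have e : (m + m) * κ = 4 * k := by rw [add_mul, ← hκ]; ring
        rw [e]
        have a1 : a.natDegree ≤ 2 * k - 1 := natDegree_parityPart 1 u
        have b1 : b.natDegree ≤ 2 * k - 1 := natDegree_parityPart 0 u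
        refine lt_of_le_of_lt (Polynomial.natDegree_add_le_of_degree_le (n := 4 * k - 2)
          (Polynomial.natDegree_mul_le.trans ?_) (Polynomial.natDegree_mul_le.trans ?_)) (by omega)
        · have := Polynomial.natDegree_map_le (f := starRingEnd ℂ) (p := a)
          omega
        · have := Polynomial.natDegree_map_le (f := starRingEnd ℂ) (p := b)
          omega
      · rw [Finset.disjoint_left]
        rintro z hz hz'
        obtain ⟨i, hi, rfl⟩ := Finset.mem_image.1 hz
        obtain ⟨j, hj, hij⟩ := Finset.mem_image.1 hz'
        exact hopp i (Finset.mem_range.1 hi) j (Finset.mem_range.1 hj) hij.symm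
  obtain ⟨a0, b0⟩ := eq_zero_of_mul_conj_add_mul_conj hN0
  exact hu (eq_zero_of_parityPart_eq_zero a0 b0)

/-- The denominator has no zero if the points are symmetric with respect to zero. -/
theorem SymmetricPoints.confluentDet_ne_zero_of_neg (h : SymmetricPoints k m w) (hk : 1 ≤ k)
    (hinj : Set.InjOn w (Finset.range m)) (hneg : ∀ i < m, ∃ j < m, w i = -w j) (x t : ℝ) :
    confluentDet k m w (entry21 k) x t ≠ 0 := by
  intro h0
  obtain ⟨κ, hκ⟩ := h.dvd
  obtain ⟨u, hu, hv⟩ := h.exists_of_confluentDet_eq_zero hκ.symm h0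
  set a := parityPart 1 u with ha
  set b := parityPart 0 u with hb
  have key (i : ℕ) (hi : i < m) :
      κ ≤ analyticOrderAt (fun z => (2 * a).eval z * wave I x t z) (w i) ∧
      κ ≤ analyticOrderAt (fun z => (2 * b).eval z * wave (-I) x t z) (w i) := by
    -- The substitution z ↦ -z maps af + bg to -af + bg and permutes the points, so difference and
    -- sum isolate 2af and 2bg. Each polynomial then has mκ = 2k zeros but degree at most 2k - 1.
    obtain ⟨j, hj, e⟩ := hneg i hi
    have d := (differentiable_eval_mul_wave a I x t).fun_add
      (differentiable_eval_mul_wave b (-I) x t)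
    have v1 := (hv i hi).1
    have v2 := le_analyticOrderAt_comp_neg d (hv j hj).1
    rw [← e] at v2
    constructor
    · refine (le_min v1 v2).trans (le_analyticOrderAt_sub.trans_eq ?_)
      congr 1
      funext z
      simp only [Pi.sub_apply, ha, hb, wave_neg, eval_neg_parityPart_zero, eval_neg_parityPart_one,
        Polynomial.eval_mul, Polynomial.eval_ofNat]
      ring
    · refine (le_min v1 v2).trans (le_analyticOrderAt_add.trans_eq ?_)
      congr 1
      funext z
      simp only [Pi.add_apply, ha, hb, wave_neg, eval_neg_parityPart_zero, eval_neg_parityPart_one,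
        Polynomial.eval_mul, Polynomial.eval_ofNat]
      ring
  have hz (p : Polynomial ℂ) (hp : p.natDegree ≤ 2 * k - 1)
      (hd : ∀ i < m, (Polynomial.X - Polynomial.C (w i)) ^ κ ∣ 2 * p) : p = 0 := by
    classical
    have h2 : 2 * p = 0 := by
      refine eq_zero_of_forall_pow_dvd (n := κ) (T := (Finset.range m).image w) ?_ ?_
      · intro z hz
        obtain ⟨i, hi, rfl⟩ := Finset.mem_image.1 hz
        exact hd i (Finset.mem_range.1 hi)
      · rw [Finset.card_image_of_injOn hinj, Finset.card_range, ← hκ]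
        refine lt_of_le_of_lt (Polynomial.natDegree_mul_le.trans ?_)
          (show 2 * k - 1 < 2 * k by omega)
        rw [Polynomial.natDegree_ofNat, zero_add]
        exact hp
    exact (mul_eq_zero.1 h2).resolve_left two_ne_zero
  refine hu (eq_zero_of_parityPart_eq_zero ?_ ?_)
  · exact hz a (natDegree_parityPart 1 u) fun i hi => dvd_of_le_analyticOrderAt_mul
      ((differentiable_wave I x t).analyticAt _) (wave_ne_zero _ _ _ _) (key i hi).1
  · exact hz b (natDegree_parityPart 0 u) fun i hi => dvd_of_le_analyticOrderAt_mul
      ((differentiable_wave (-I) x t).analyticAt _) (wave_ne_zero _ _ _ _) (key i hi).2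

end Combination

end DNLS

namespace DNLS

/-! ### Divided differences as Cauchy integrals -/

section DividedDifference

/-- The divided difference of `F` at the nodes `ν 0, …, ν l`, as a Cauchy integral over the unit
circle around `a`. -/
noncomputable def divDiff (F : ℂ → ℂ) (a : ℂ) (ν : ℕ → ℂ) (l : ℕ) : ℂ :=
  (2 * Real.pi * I)⁻¹ * ∮ z in C(a, 1), (∏ i ∈ Finset.range (l + 1), (z - ν i)⁻¹) * F z

/-- Newton interpolation of the Cauchy kernel, by iterating 1/(z-y) = 1/(z-ν) + (y-ν)/(z-ν) ·
1/(z-y). At a node the remainder vanishes, and no distinctness of the nodes is needed. -/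
theorem inv_sub_eq_sum (ν : ℕ → ℂ) {z y : ℂ} (hy : z ≠ y) (L : ℕ) (hν : ∀ i < L, z ≠ ν i) :
    (z - y)⁻¹ = ∑ l ∈ Finset.range L, (∏ i ∈ Finset.range l, (y - ν i)) *
        (∏ i ∈ Finset.range (l + 1), (z - ν i)⁻¹)
      + (∏ i ∈ Finset.range L, (y - ν i)) * (∏ i ∈ Finset.range L, (z - ν i)⁻¹) * (z - y)⁻¹ := by
  induction L with
  | zero => simp
  | succ L ih =>
    have h1 : z - ν L ≠ 0 := sub_ne_zero.2 (hν L (by omega))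
    have h2 : z - y ≠ 0 := sub_ne_zero.2 hy
    have h3 : (z - y)⁻¹ = (z - ν L)⁻¹ + (y - ν L) * (z - ν L)⁻¹ * (z - y)⁻¹ := by
      field_simp; ring
    rw [Finset.sum_range_succ, Finset.prod_range_succ, Finset.prod_range_succ _ L]
    conv_lhs => rw [ih fun i hi => hν i (by omega)]
    linear_combination (∏ i ∈ Finset.range L, (y - ν i)) *
      (∏ i ∈ Finset.range L, (z - ν i)⁻¹) * h3

theorem inv_sub_node_eq_sum (ν : ℕ → ℂ) {z : ℂ} (j : ℕ) (hν : ∀ i, z ≠ ν i) :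
    (z - ν j)⁻¹ = ∑ l ∈ Finset.range (j + 1), (∏ i ∈ Finset.range l, (ν j - ν i)) *
        (∏ i ∈ Finset.range (l + 1), (z - ν i)⁻¹) := by
  have h0 : ∏ i ∈ Finset.range (j + 1), (ν j - ν i) = 0 :=
    Finset.prod_eq_zero (Finset.self_mem_range_succ j) (sub_self _)
  have h := inv_sub_eq_sum ν (hν j) (j + 1) fun i _ => hν i
  rwa [h0, zero_mul, zero_mul, add_zero] at h

theorem ne_of_mem_sphere {a z y : ℂ} (hz : z ∈ Metric.sphere a 1) (hy : ‖y - a‖ < 1) : z ≠ y := by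
  rintro rfl
  rw [mem_sphere_iff_norm] at hz
  linarith

theorem continuousOn_prod_inv_mul {F : ℂ → ℂ} (hF : Continuous F) {a : ℂ} {ν : ℕ → ℂ}
    (hν : ∀ i, ‖ν i - a‖ < 1) (l : ℕ) :
    ContinuousOn (fun z => (∏ i ∈ Finset.range (l + 1), (z - ν i)⁻¹) * F z)
      (Metric.sphere a 1) := by
  refine ContinuousOn.mul (continuousOn_finsetProd _ fun i _ => ?_) hF.continuousOn
  exact (continuousOn_id.sub continuousOn_const).inv₀ fun z hz =>
    sub_ne_zero.2 (ne_of_mem_sphere hz (hν i))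

/-- Newton's interpolation formula at a node. -/
theorem newton_formula {F : ℂ → ℂ} (hF : Differentiable ℂ F) {a : ℂ} {ν : ℕ → ℂ}
    (hν : ∀ i, ‖ν i - a‖ < 1) (j : ℕ) :
    F (ν j) = ∑ l ∈ Finset.range (j + 1),
      (∏ i ∈ Finset.range l, (ν j - ν i)) * divDiff F a ν l := by
  have hc : DiffContOnCl ℂ F (Metric.ball a 1) := hF.diffContOnCl
  have h1 := hc.two_pi_i_inv_smul_circleIntegral_sub_inv_smul
    (mem_ball_iff_norm.2 (hν j))
  simp only [smul_eq_mul] at h1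
  rw [← h1]
  have h2 : (∮ z in C(a, 1), (z - ν j)⁻¹ * F z)
      = ∮ z in C(a, 1), ∑ l ∈ Finset.range (j + 1), (∏ i ∈ Finset.range l, (ν j - ν i)) *
        ((∏ i ∈ Finset.range (l + 1), (z - ν i)⁻¹) * F z) := by
    refine circleIntegral.integral_congr zero_le_one fun z hz => ?_
    simp only [inv_sub_node_eq_sum ν j fun i => ne_of_mem_sphere hz (hν i), Finset.sum_mul,
      mul_assoc]
  rw [h2, circleIntegral.integral_fun_sum, Finset.mul_sum]
  · refine Finset.sum_congr rfl fun l _ => ?_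
    rw [circleIntegral.integral_const_mul, divDiff]
    ring
  · intro l _
    exact (ContinuousOn.mul continuousOn_const
      (continuousOn_prod_inv_mul hF.continuous hν l)).circleIntegrable zero_le_one

theorem divDiff_const {F : ℂ → ℂ} (hF : Differentiable ℂ F) (a : ℂ) (l : ℕ) :
    divDiff F a (fun _ => a) l = taylorCoeff F l a := by
  have h := hF.differentiableOn.circleIntegral_one_div_sub_center_pow_smul (c := a) one_pos l
  simp only [smul_eq_mul, one_div] at h
  simp only [divDiff, Finset.prod_const, Finset.card_range, inv_pow, h, taylorCoeff]
  have hpi : (2 * Real.pi * I : ℂ) ≠ 0 := two_pi_I_ne_zero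
  rw [div_mul_eq_mul_div, mul_div_assoc, inv_mul_cancel_left₀ hpi]

theorem norm_inv_sub_le {a z y : ℂ} (hz : ‖z - a‖ = 1) (hy : ‖y - a‖ < 1 / 2) :
    ‖(z - y)⁻¹‖ ≤ 2 := by
  have h1 : ‖z - a‖ ≤ ‖z - y‖ + ‖y - a‖ := by
    simpa using norm_add_le (z - y) (y - a)
  rw [norm_inv]
  calc ‖z - y‖⁻¹ ≤ (1 / 2)⁻¹ := inv_anti₀ (by norm_num) (by linarith)
    _ = 2 := by norm_num

/-- Divided differences at coalescing nodes tend to the Taylor coefficient. -/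
theorem tendsto_divDiff {T : Type*} {𝓕 : Filter T} [𝓕.IsCountablyGenerated] {F : ℂ → ℂ}
    (hF : Differentiable ℂ F) {a : ℂ} {ν : T → ℕ → ℂ}
    (hν : ∀ i, Tendsto (fun τ => ν τ i) 𝓕 (𝓝 a)) (l : ℕ) :
    Tendsto (fun τ => divDiff F a (ν τ) l) 𝓕 (𝓝 (taylorCoeff F l a)) := by
  have hnear : ∀ᶠ τ in 𝓕, ∀ i ∈ Finset.range (l + 1), ‖ν τ i - a‖ < 1 / 2 := by
    refine (Finset.eventually_all _).2 fun i _ => ?_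
    have := (hν i).eventually (Metric.ball_mem_nhds a (show (0 : ℝ) < 1 / 2 by norm_num))
    filter_upwards [this] with τ hτ
    exact mem_ball_iff_norm.1 hτ
  obtain ⟨C, hC⟩ := (isCompact_sphere a 1).exists_bound_of_continuousOn
    hF.continuous.continuousOn
  rw [← divDiff_const hF]
  refine Tendsto.const_mul _ ?_
  unfold circleIntegral
  have hs (θ : ℝ) : circleMap a 1 θ ∈ Metric.sphere a 1 := circleMap_mem_sphere a zero_le_one θ
  have hs' (θ : ℝ) : ‖circleMap a 1 θ - a‖ = 1 := mem_sphere_iff_norm.1 (hs θ)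
  -- Nodes within 1/2 of the centre stay at distance at least 1/2 from the unit circle, so each of
  -- the l + 1 inverse factors is at most 2.
  refine intervalIntegral.tendsto_integral_filter_of_dominated_convergence
    (fun _ => 2 ^ (l + 1) * C) ?_ ?_ intervalIntegrable_const ?_
  · filter_upwards [hnear] with τ hτ
    refine Continuous.aestronglyMeasurable ?_
    have h1 : Continuous (deriv (circleMap a 1)) := by
      simp only [funext (deriv_circleMap a 1)]; fun_prop
    refine h1.smul (Continuous.mul (continuous_finsetProd _ fun i hi => ?_)
      (hF.continuous.comp (continuous_circleMap a 1)))
    refine ((continuous_circleMap a 1).sub continuous_const).inv₀ fun θ => ?_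
    refine sub_ne_zero.2 (ne_of_mem_sphere (hs θ) ((hτ i hi).trans (by norm_num)))
  · filter_upwards [hnear] with τ hτ
    refine Eventually.of_forall fun θ _ => ?_
    rw [norm_smul, norm_mul, deriv_circleMap, norm_mul, norm_I, mul_one, norm_circleMap_zero,
      abs_one, one_mul]
    refine mul_le_mul ?_ (hC _ (hs θ)) (norm_nonneg _) (by positivity)
    rw [norm_prod]
    refine (Finset.prod_le_prod (fun _ _ => norm_nonneg _)
      fun i hi => norm_inv_sub_le (hs' θ) (hτ i hi)).trans ?_
    simp
  · refine Eventually.of_forall fun θ _ => Tendsto.const_smul (Tendsto.mul_const _ ?_) _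
    refine tendsto_finsetProd _ fun i _ => Tendsto.inv₀ (tendsto_const_nhds.sub (hν i)) ?_
    rw [sub_ne_zero]
    exact ne_of_mem_sphere (hs θ) (by simp)

end DividedDifference

/-! ### Coalescence of nodes within clusters -/

section Confluence

/-- The coefficients of Newton's interpolation formula, for nodes in `m` clusters. -/
noncomputable def newtonMatrix (n m : ℕ) (ν : ℕ → ℕ → ℂ) : Matrix (Fin n) (Fin n) ℂ :=
  Matrix.of fun r s => if (s : ℕ) % m = (r : ℕ) % m ∧ (s : ℕ) / m ≤ (r : ℕ) / m then
    ∏ i ∈ Finset.range ((s : ℕ) / m), (ν ((r : ℕ) % m) ((r : ℕ) / m) - ν ((r : ℕ) % m) i) else 0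

theorem newtonMatrix_mul {n m : ℕ} (hm : 0 < m) {F : Fin n → ℂ → ℂ}
    (hF : ∀ c, Differentiable ℂ (F c)) {a : ℕ → ℂ} {ν : ℕ → ℕ → ℂ}
    (hν : ∀ j < m, ∀ i, ‖ν j i - a j‖ < 1) :
    newtonMatrix n m ν * (Matrix.of fun s c : Fin n =>
        divDiff (F c) (a ((s : ℕ) % m)) (ν ((s : ℕ) % m)) ((s : ℕ) / m))
      = Matrix.of fun r c : Fin n => F c (ν ((r : ℕ) % m) ((r : ℕ) / m)) := by
  ext r c
  have hrm := Nat.mod_lt (r : ℕ) hm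
  rw [Matrix.of_apply, newton_formula (hF c) (hν _ hrm), Matrix.mul_apply]
  simp only [newtonMatrix, Matrix.of_apply, ite_mul, zero_mul]
  rw [← Finset.sum_filter]
  have hdm := Nat.div_add_mod (r : ℕ) m
  have hlt (l : ℕ) (hl : l ∈ Finset.range ((r : ℕ) / m + 1)) : m * l + (r : ℕ) % m < n := by
    have : m * l ≤ m * ((r : ℕ) / m) :=
      Nat.mul_le_mul_left m (Nat.lt_succ_iff.1 (Finset.mem_range.1 hl))
    omega
  symm
  refine Finset.sum_bij (fun l hl => (⟨m * l + (r : ℕ) % m, hlt l hl⟩ : Fin n)) ?_ ?_ ?_ ?_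
  · intro l hl
    simp only [Finset.mem_filter, Finset.mem_univ, true_and, Nat.mul_add_mod, Nat.mod_mod,
      Nat.mul_add_div hm, Nat.div_eq_of_lt hrm, add_zero]
    exact Nat.lt_succ_iff.1 (Finset.mem_range.1 hl)
  · intro l hl l' hl' h
    have h1 : m * l + (r : ℕ) % m = m * l' + (r : ℕ) % m := congrArg Fin.val h
    exact Nat.eq_of_mul_eq_mul_left hm (by omega)
  · intro s hs
    obtain ⟨-, h1, h2⟩ := Finset.mem_filter.1 hs
    refine ⟨(s : ℕ) / m, Finset.mem_range.2 (by omega), Fin.ext ?_⟩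
    simp only [← h1]
    exact Nat.div_add_mod _ _
  · intro l hl
    simp only [Nat.mul_add_mod, Nat.mod_mod, Nat.mul_add_div hm, Nat.div_eq_of_lt hrm, add_zero]

theorem det_newtonMatrix_ne_zero {n m : ℕ} {ν : ℕ → ℕ → ℂ}
    (hν : ∀ r < n, ∀ i < r / m, ν (r % m) (r / m) ≠ ν (r % m) i) :
    (newtonMatrix n m ν).det ≠ 0 := by
  rw [Matrix.det_of_isLowerTriangular]
  · refine Finset.prod_ne_zero_iff.2 fun r _ => ?_
    simp only [newtonMatrix, Matrix.of_apply, le_refl, and_self, if_true]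
    exact Finset.prod_ne_zero_iff.2 fun i hi =>
      sub_ne_zero.2 (hν r r.2 i (Finset.mem_range.1 hi))
  · intro r s hrs
    have hrs : r < s := hrs
    simp only [newtonMatrix, Matrix.of_apply]
    rw [if_neg]
    rintro ⟨h1, h2⟩
    have e1 := Nat.div_add_mod (r : ℕ) m
    have e2 := Nat.div_add_mod (s : ℕ) m
    have := Nat.mul_le_mul_left m h2
    have : (r : ℕ) < s := hrs
    omega

/-- The determinant with the entries evaluated at the nodes `ν j i`, in `m` clusters. -/
noncomputable def nodeDet (k m : ℕ) (ν : ℕ → ℕ → ℂ) (e : Fin (2 * k) → ℂ → ℂ → ℂ → ℂ)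
    (x t : ℝ) : ℂ :=
  Matrix.det (Matrix.of fun r c : Fin (2 * k) =>
    e c (ν ((r : ℕ) % m) ((r : ℕ) / m)) (vacF x t (ν ((r : ℕ) % m) ((r : ℕ) / m)))
      (vacG x t (ν ((r : ℕ) % m) ((r : ℕ) / m))))

/-- The determinant of the divided differences of the entries. -/
noncomputable def divDiffDet (k m : ℕ) (w : ℕ → ℂ) (ν : ℕ → ℕ → ℂ)
    (e : Fin (2 * k) → ℂ → ℂ → ℂ → ℂ) (x t : ℝ) : ℂ :=
  Matrix.det (Matrix.of fun s c : Fin (2 * k) =>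
    divDiff (fun z => e c z (vacF x t z) (vacG x t z)) (w ((s : ℕ) % m)) (ν ((s : ℕ) % m))
      ((s : ℕ) / m))

theorem differentiable_entry21 (k : ℕ) (c : Fin (2 * k)) (x t : ℝ) :
    Differentiable ℂ fun z => entry21 k c z (vacF x t z) (vacG x t z) := by
  simp only [entry21_eq]
  exact (contDiff_pow_mul_wave _ _ x t (n := 1)).differentiable (by simp)

theorem differentiable_entry11 (k : ℕ) (c : Fin (2 * k)) (x t : ℝ) :
    Differentiable ℂ fun z => entry11 k c z (vacF x t z) (vacG x t z) := by
  simp only [entry11_eq]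
  exact (contDiff_pow_mul_wave _ _ x t (n := 1)).differentiable (by simp)

theorem differentiable_entry12 (k : ℕ) (c : Fin (2 * k)) (x t : ℝ) :
    Differentiable ℂ fun z => entry12 k c z (vacF x t z) (vacG x t z) := by
  simp only [entry12_eq]
  exact (contDiff_pow_mul_wave _ _ x t (n := 1)).differentiable (by simp)

/-- The singular Newton factor depends only on the nodes and not on the entries `e`. -/
theorem nodeDet_eq {k m : ℕ} (hm : 0 < m) {w : ℕ → ℂ} {ν : ℕ → ℕ → ℂ}
    (hν : ∀ j < m, ∀ i, ‖ν j i - w j‖ < 1) {e : Fin (2 * k) → ℂ → ℂ → ℂ → ℂ} {x t : ℝ}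
    (he : ∀ c, Differentiable ℂ fun z => e c z (vacF x t z) (vacG x t z)) :
    nodeDet k m ν e x t = (newtonMatrix (2 * k) m ν).det * divDiffDet k m w ν e x t := by
  rw [divDiffDet, ← Matrix.det_mul, newtonMatrix_mul hm he hν, nodeDet]

theorem tendsto_divDiffDet {k m : ℕ} (hm : 0 < m) {T : Type*} {𝓕 : Filter T}
    [𝓕.IsCountablyGenerated] {w : ℕ → ℂ} {ν : T → ℕ → ℕ → ℂ}
    (hν : ∀ j < m, ∀ i, Tendsto (fun τ => ν τ j i) 𝓕 (𝓝 (w j)))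
    {e : Fin (2 * k) → ℂ → ℂ → ℂ → ℂ} {x t : ℝ}
    (he : ∀ c, Differentiable ℂ fun z => e c z (vacF x t z) (vacG x t z)) :
    Tendsto (fun τ => divDiffDet k m w (ν τ) e x t) 𝓕 (𝓝 (confluentDet k m w e x t)) := by
  simp only [divDiffDet, confluentDet, Matrix.det_apply']
  refine tendsto_finsetSum _ fun σ _ => Tendsto.const_mul _ (tendsto_finsetProd _ fun i _ => ?_)
  exact tendsto_divDiff (he _) (hν _ (Nat.mod_lt _ hm)) _

/-- The ratio of determinants converges when the nodes coalesce within each cluster. -/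
theorem tendsto_nodeDet_ratio {k m : ℕ} (hm : 0 < m) {T : Type*} {𝓕 : Filter T}
    [𝓕.IsCountablyGenerated] {w : ℕ → ℂ} {ν : T → ℕ → ℕ → ℂ}
    (hν : ∀ j < m, ∀ i, Tendsto (fun τ => ν τ j i) 𝓕 (𝓝 (w j)))
    (hnear : ∀ᶠ τ in 𝓕, ∀ j < m, ∀ i, ‖ν τ j i - w j‖ < 1)
    (hne : ∀ᶠ τ in 𝓕, ∀ r < 2 * k, ∀ i < r / m, ν τ (r % m) (r / m) ≠ ν τ (r % m) i) {x t : ℝ}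
    (hd : confluentDet k m w (entry21 k) x t ≠ 0) :
    Tendsto (fun τ => 2 * I * (nodeDet k m (ν τ) (entry11 k) x t *
        nodeDet k m (ν τ) (entry12 k) x t) / nodeDet k m (ν τ) (entry21 k) x t ^ 2) 𝓕
      (𝓝 (2 * I * (confluentDet k m w (entry11 k) x t * confluentDet k m w (entry12 k) x t)
        / confluentDet k m w (entry21 k) x t ^ 2)) := by
  have h11 := tendsto_divDiffDet hm hν fun c => differentiable_entry11 k c x t
  have h12 := tendsto_divDiffDet hm hν fun c => differentiable_entry12 k c x t
  have h21 := tendsto_divDiffDet hm hν fun c => differentiable_entry21 k c x t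
  refine (((h11.mul h12).const_mul (2 * I)).div (h21.pow 2) (pow_ne_zero 2 hd)).congr' ?_
  filter_upwards [hnear, hne] with τ h1 h2
  have hN := det_newtonMatrix_ne_zero h2
  rw [nodeDet_eq hm h1 fun c => differentiable_entry11 k c x t,
    nodeDet_eq hm h1 fun c => differentiable_entry12 k c x t,
    nodeDet_eq hm h1 fun c => differentiable_entry21 k c x t]
  simp only [Pi.div_apply]
  -- The Newton determinant occurs squared in both numerator and denominator.
  rw [mul_pow, ← mul_div_mul_left _ _ (pow_ne_zero 2 hN)]
  ring

end Confluence

end DNLS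

namespace DNLS

/-! ### The pair λ₁, -λ₁^* -/

section TwoPoints

theorem symmetricPoints_pair {k : ℕ} {a b : ℂ} (ha : a ≠ 0) (hb : b = -(starRingEnd ℂ) a) :
    SymmetricPoints k 2 (fun i => if i = 0 then a else b) where
  pos := two_pos
  dvd := dvd_mul_right 2 k
  conj i hi := by interval_cases i <;> simp [hb]
  ne_zero i hi := by interval_cases i <;> simp [hb, ha]

theorem delta21_ne_zero {k : ℕ} (hk : 1 ≤ k) {a b : ℂ} (ha : a.re ≠ 0)
    (hb : b = -(starRingEnd ℂ) a) (x t : ℝ) : delta21 k a b x t ≠ 0 := by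
  have ha0 : a ≠ 0 := fun h => ha (by simp [h])
  have hab : a ≠ b := fun h => ha (by
    have := congrArg re h
    rw [hb, neg_re, conj_re] at this
    linarith)
  have hinj : Set.InjOn (fun i : ℕ => if i = 0 then a else b) (Finset.range 2) := by
    intro i hi j hj hij
    simp only [Finset.coe_range, Set.mem_Iio] at hi hj
    interval_cases i <;> interval_cases j <;> simp_all
  have hs := symmetricPoints_pair (k := k) ha0 hb
  rw [delta21, taylorDet_eq_confluentDet]
  -- For real a the two points are opposite to each other. Otherwise neither is opposite to the
  -- other or to itself.
  by_cases him : a.im = 0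
  · refine hs.confluentDet_ne_zero_of_neg hk hinj (fun i hi => ⟨1 - i, by omega, ?_⟩) x t
    have : (starRingEnd ℂ) a = a := conj_eq_iff_im.2 him
    interval_cases i <;> simp [hb, this]
  · refine hs.confluentDet_ne_zero hk hinj (fun i hi j hj => ?_) x t
    have h1 : (starRingEnd ℂ) a ≠ a := fun h => him (conj_eq_iff_im.1 h)
    interval_cases i <;> interval_cases j <;>
      simp [hb, self_eq_neg, neg_eq_self, ha0, h1, Ne.symm h1]

theorem isSolution_qSame {k : ℕ} (hk : 1 ≤ k) {a b : ℂ} (ha : a.re ≠ 0)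
    (hb : b = -(starRingEnd ℂ) a) : IsSolution (qSame k a b) :=
  (symmetricPoints_pair (fun h => ha (by simp [h])) hb).isSolution hk
    fun x t => delta21_ne_zero hk ha hb x t

end TwoPoints

/-! ### The Darboux transformation with coalescing eigenvalues -/

section Nodes

/-- The eigenvalues `μ`, continued by the constant `d`. -/
noncomputable def extendBy {k : ℕ} (μ : Fin k → ℂ) (d : ℂ) (i : ℕ) : ℂ :=
  if h : i < k then μ ⟨i, h⟩ else d

theorem extendBy_of_lt {k : ℕ} (μ : Fin k → ℂ) (d : ℂ) {i : ℕ} (h : i < k) :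
    extendBy μ d i = μ ⟨i, h⟩ := dif_pos h

theorem continuous_extendBy {k : ℕ} (d : ℂ) (i : ℕ) :
    Continuous (fun μ : Fin k → ℂ => extendBy μ d i) := by
  by_cases h : i < k
  · simp only [extendBy_of_lt _ _ h]; fun_prop
  · simp only [extendBy, dif_neg h]; fun_prop

theorem extendBy_const {k : ℕ} (d : ℂ) (i : ℕ) : extendBy (fun _ : Fin k => d) d i = d := by
  simp [extendBy]

theorem tendsto_extendBy {k : ℕ} (d : ℂ) (i : ℕ) (S : Set (Fin k → ℂ)) :
    Tendsto (fun μ : Fin k → ℂ => extendBy μ d i) (𝓝[S] fun _ => d) (𝓝 d) := by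
  have := (continuous_extendBy (k := k) d i).tendsto fun _ => d
  rw [extendBy_const] at this
  exact this.mono_left nhdsWithin_le_nhds

theorem eventually_norm_extendBy_sub_lt {k : ℕ} (d : ℂ) (S : Set (Fin k → ℂ)) :
    ∀ᶠ μ in 𝓝[S] (fun _ : Fin k => d), ∀ i, ‖extendBy μ d i - d‖ < 1 := by
  have h : ∀ᶠ μ in 𝓝[S] (fun _ : Fin k => d), ∀ i : Fin k, ‖extendBy μ d i - d‖ < 1 := by
    refine eventually_all.2 fun i => ?_
    filter_upwards [tendsto_extendBy d i S (Metric.ball_mem_nhds d one_pos)] with μ hμ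
    exact mem_ball_iff_norm.1 hμ
  filter_upwards [h] with μ hμ i
  by_cases hi : i < k
  · exact hμ ⟨i, hi⟩
  · simp [extendBy, hi]

/-- The reflection `z ↦ -z^*` in the rows of odd index. -/
noncomputable def reflectIf (j : ℕ) (z : ℂ) : ℂ := if j = 0 then z else -(starRingEnd ℂ) z

theorem continuous_reflectIf (j : ℕ) : Continuous (reflectIf j) := by
  unfold reflectIf
  split_ifs
  · exact continuous_id
  · exact continuous_conj.neg

theorem reflectIf_injective (j : ℕ) : Function.Injective (reflectIf j) := by
  intro a b h
  unfold reflectIf at h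
  split_ifs at h
  · exact h
  · exact (starRingEnd ℂ).injective (neg_injective h)

theorem norm_reflectIf_sub (j : ℕ) (z d : ℂ) : ‖reflectIf j z - reflectIf j d‖ = ‖z - d‖ := by
  unfold reflectIf
  split_ifs
  · rfl
  · rw [neg_sub_neg, ← map_sub, norm_conj, norm_sub_rev]

theorem conj_vacG (x t : ℝ) (z : ℂ) :
    (starRingEnd ℂ) (vacG x t z) = vacF x t (-(starRingEnd ℂ) z) := by
  simp only [vacG, vacF, ← exp_conj, map_neg, map_mul, map_add, map_pow, conj_I, conj_ofReal,
    map_ofNat, Even.neg_pow (show Even 2 by decide), Even.neg_pow (show Even 4 by decide)]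
  ring_nf

theorem conj_vacF (x t : ℝ) (z : ℂ) :
    (starRingEnd ℂ) (vacF x t z) = vacG x t (-(starRingEnd ℂ) z) := by
  simp only [vacG, vacF, ← exp_conj, map_mul, map_add, map_pow, conj_I, conj_ofReal,
    map_ofNat, Even.neg_pow (show Even 2 by decide), Even.neg_pow (show Even 4 by decide)]
  ring_nf

theorem darbouxDet_apply {k : ℕ} (e : Fin (2 * k) → ℂ → ℂ → ℂ → ℂ) (μ : Fin k → ℂ) (d : ℂ)
    (x t : ℝ) : darbouxDet k e μ x t = Matrix.det (Matrix.of fun r c : Fin (2 * k) =>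
      let z := reflectIf ((r : ℕ) % 2) (extendBy μ d ((r : ℕ) / 2))
      e c z (vacF x t z) (vacG x t z)) := by
  unfold darbouxDet
  congr 1
  ext r c
  simp only [Matrix.of_apply, reflectIf, extendBy_of_lt μ d (show (r : ℕ) / 2 < k by omega)]
  split_ifs
  · rfl
  · rw [conj_vacG, conj_vacF]

theorem qDarboux_eq_nodeDet_pair {k : ℕ} (μ : Fin k → ℂ) (d : ℂ) (x t : ℝ) :
    qDarboux k μ x t =
      2 * I * (nodeDet k 2 (fun j i => reflectIf j (extendBy μ d i)) (entry11 k) x t *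
        nodeDet k 2 (fun j i => reflectIf j (extendBy μ d i)) (entry12 k) x t)
        / nodeDet k 2 (fun j i => reflectIf j (extendBy μ d i)) (entry21 k) x t ^ 2 := by
  simp only [qDarboux, darbouxDet_apply _ μ d]
  rfl

/-- Both families of nodes are listed as one cluster, which is appropriate on the imaginary axis,
where an eigenvalue and its reflection coincide. -/
theorem qDarboux_eq_nodeDet_single {k : ℕ} (μ : Fin k → ℂ) (d : ℂ) (x t : ℝ) :
    qDarboux k μ x t =
      2 * I * (nodeDet k 1 (fun _ i => reflectIf (i % 2) (extendBy μ d (i / 2))) (entry11 k) x t *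
        nodeDet k 1 (fun _ i => reflectIf (i % 2) (extendBy μ d (i / 2))) (entry12 k) x t)
        / nodeDet k 1 (fun _ i => reflectIf (i % 2) (extendBy μ d (i / 2))) (entry21 k) x t ^ 2 := by
  simp only [qDarboux, darbouxDet_apply _ μ d, nodeDet, Nat.div_one]

/-- The Darboux transform converges as all eigenvalues coalesce. -/
theorem tendsto_qDarboux {k : ℕ} (hk : 1 ≤ k) {a b : ℂ} (ha : a.re ≠ 0)
    (hb : b = -(starRingEnd ℂ) a) (x t : ℝ) :
    Tendsto (fun μ : Fin k → ℂ => qDarboux k μ x t)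
      (𝓝[{μ : Fin k → ℂ | Function.Injective μ}] fun _ => a) (𝓝 (qSame k a b x t)) := by
  simp only [fun μ : Fin k → ℂ => qDarboux_eq_nodeDet_pair μ a x t]
  have hw (j : ℕ) : (if j = 0 then a else b) = reflectIf j a := by rw [hb]; rfl
  have hd := delta21_ne_zero hk ha hb x t
  rw [delta21, taylorDet_eq_confluentDet] at hd
  simp only [qSame, delta11, delta12, delta21, taylorDet_eq_confluentDet]
  refine tendsto_nodeDet_ratio two_pos (fun j _ i => ?_) ?_ ?_ hd
  · simp only [hw]
    exact ((continuous_reflectIf j).tendsto a).comp (tendsto_extendBy a i _)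
  · filter_upwards [eventually_norm_extendBy_sub_lt a _] with μ hμ j _ i
    simp only [hw, norm_reflectIf_sub]
    exact hμ i
  · filter_upwards [self_mem_nhdsWithin] with μ hμ r hr i hi h
    have h1 := reflectIf_injective _ h
    rw [extendBy_of_lt _ _ (show r / 2 < k by omega),
      extendBy_of_lt _ _ (show i < k by omega)] at h1
    have := congrArg Fin.val (hμ h1)
    simp only at this
    omega

end Nodes

/-! ### The limit on the imaginary axis -/

section Rational

/-- The eigenvalues for which the nodes of the Darboux transformation are distinct. -/
def separated (k : ℕ) : Set (Fin k → ℂ) :=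
  {μ | Function.Injective μ ∧ ∀ i j, μ i ≠ -(starRingEnd ℂ) (μ j)}

theorem symmetricPoints_single {k : ℕ} {a : ℂ} (ha : a ≠ 0) (h : -(starRingEnd ℂ) a = a) :
    SymmetricPoints k 1 (fun _ => a) where
  pos := one_pos
  dvd := one_dvd _
  conj _ _ := h
  ne_zero _ _ := ha

theorem confluentDet_single_ne_zero {k : ℕ} (hk : 1 ≤ k) {a : ℂ} (ha : a ≠ 0)
    (h : -(starRingEnd ℂ) a = a) (x t : ℝ) :
    confluentDet k 1 (fun _ => a) (entry21 k) x t ≠ 0 := by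
  refine (symmetricPoints_single ha h).confluentDet_ne_zero hk ?_ (fun i _ j _ => ?_) x t
  · intro i hi j hj _
    simp only [Finset.coe_range, Set.mem_Iio] at hi hj
    omega
  · rwa [Ne, self_eq_neg]

theorem tendsto_qDarboux_separated {k : ℕ} (hk : 1 ≤ k) {a : ℂ} (ha : a ≠ 0)
    (h : -(starRingEnd ℂ) a = a) (x t : ℝ) :
    Tendsto (fun μ : Fin k → ℂ => qDarboux k μ x t) (𝓝[separated k] fun _ => a)
      (𝓝 (2 * I * (confluentDet k 1 (fun _ => a) (entry11 k) x t *
        confluentDet k 1 (fun _ => a) (entry12 k) x t)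
        / confluentDet k 1 (fun _ => a) (entry21 k) x t ^ 2)) := by
  simp only [fun μ : Fin k → ℂ => qDarboux_eq_nodeDet_single μ a x t]
  have hw (j : ℕ) : reflectIf j a = a := by
    unfold reflectIf; split_ifs
    · rfl
    · exact h
  refine tendsto_nodeDet_ratio one_pos (fun j _ i => ?_) ?_ ?_
    (confluentDet_single_ne_zero hk ha h x t)
  · have := ((continuous_reflectIf (i % 2)).tendsto a).comp (tendsto_extendBy a (i / 2)
      (separated k))
    rwa [hw] at this
  · filter_upwards [eventually_norm_extendBy_sub_lt a _] with μ hμ j _ i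
    have := norm_reflectIf_sub (i % 2) (extendBy μ a (i / 2)) a
    rw [hw] at this
    rw [this]
    exact hμ _
  · filter_upwards [self_mem_nhdsWithin] with μ hμ r hr i hi
    rw [Nat.div_one] at hi ⊢
    rw [extendBy_of_lt _ _ (show r / 2 < k by omega), extendBy_of_lt _ _ (show i / 2 < k by omega)]
    unfold reflectIf
    split_ifs with h1 h2 h2
    · intro he
      have := congrArg Fin.val (hμ.1 he)
      simp only at this
      omega
    · exact hμ.2 _ _
    · exact (hμ.2 _ _).symm
    · intro he
      have := congrArg Fin.val (hμ.1 ((starRingEnd ℂ).injective (neg_injective he)))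
      simp only at this
      omega

theorem eventually_separated {k : ℕ} {a : ℂ} (ha : a.re ≠ 0) :
    ∀ᶠ μ in 𝓝[{μ : Fin k → ℂ | Function.Injective μ}] (fun _ => a), μ ∈ separated k := by
  have h : ∀ᶠ μ in 𝓝 (fun _ : Fin k => a), ∀ i j, μ i ≠ -(starRingEnd ℂ) (μ j) := by
    refine eventually_all.2 fun i => eventually_all.2 fun j => ?_
    have hc : Continuous (fun μ : Fin k → ℂ => -(starRingEnd ℂ) (μ j)) :=
      (continuous_conj.comp (continuous_apply j)).neg
    refine (isOpen_ne_fun (continuous_apply i) hc).mem_nhds fun h => ha ?_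
    have := congrArg re h
    rw [neg_re, conj_re] at this
    linarith
  filter_upwards [self_mem_nhdsWithin, nhdsWithin_le_nhds h] with μ h1 h2
  exact ⟨h1, h2⟩

/-- Nontriviality of this filter allows closed sets containing values of `qDarboux` to be passed on
to the limit `qSame`. -/
theorem neBot_nhdsWithin_injective (k : ℕ) (a : ℂ) :
    (𝓝[{μ : Fin k → ℂ | Function.Injective μ}] fun _ => a).NeBot := by
  rw [← mem_closure_iff_nhdsWithin_neBot]
  have hc : Continuous (fun s : ℝ => fun i : Fin k => a + (s : ℂ) * ((i : ℕ) : ℂ)) := by fun_prop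
  have ht := (hc.tendsto 0).mono_left (nhdsWithin_le_nhds (s := {0}ᶜ))
  have e : (fun i : Fin k => a + ((0 : ℝ) : ℂ) * ((i : ℕ) : ℂ)) = fun _ => a := by simp
  rw [e] at ht
  refine mem_closure_of_tendsto ht ?_
  filter_upwards [self_mem_nhdsWithin] with s hs i j hij
  have hs' : (s : ℂ) ≠ 0 := ofReal_ne_zero.2 hs
  have := mul_left_cancel₀ hs' (add_left_cancel hij)
  exact Fin.ext (by exact_mod_cast this)

/-- The solutions with coalesced eigenvalues converge as the eigenvalue tends to the imaginary
axis. -/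
theorem tendsto_qSame {k : ℕ} (hk : 1 ≤ k) {β : ℝ} (hβ : β ≠ 0) (x t : ℝ) :
    Tendsto (fun α : ℝ => qSame k ((α : ℂ) + I * (β : ℂ))
        (-(starRingEnd ℂ) ((α : ℂ) + I * (β : ℂ))) x t) (𝓝[≠] 0)
      (𝓝 (2 * I * (confluentDet k 1 (fun _ => I * (β : ℂ)) (entry11 k) x t *
        confluentDet k 1 (fun _ => I * (β : ℂ)) (entry12 k) x t)
        / confluentDet k 1 (fun _ => I * (β : ℂ)) (entry21 k) x t ^ 2)) := by
  have ha : I * (β : ℂ) ≠ 0 := mul_ne_zero I_ne_zero (ofReal_ne_zero.2 hβ)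
  have ht := tendsto_qDarboux_separated hk ha (by simp) x t
  -- An iterated limit: near the imaginary point `qDarboux` takes values in a given closed
  -- neighbourhood for all separated eigenvalues. Each `qSame` with small α ≠ 0 is a limit of such
  -- values, hence lies in it too.
  rw [(closed_nhds_basis _).tendsto_right_iff]
  rintro W ⟨hW, hWc⟩
  obtain ⟨U, hU, hUW⟩ := mem_nhdsWithin_iff_exists_mem_nhds_inter.1 (ht hW)
  have hp : Tendsto (fun α : ℝ => fun _ : Fin k => (α : ℂ) + I * (β : ℂ)) (𝓝[≠] 0)
      (𝓝 fun _ => I * (β : ℂ)) := by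
    have hc : Continuous (fun α : ℝ => fun _ : Fin k => (α : ℂ) + I * (β : ℂ)) := by fun_prop
    have := hc.tendsto 0
    simp only [ofReal_zero, zero_add] at this
    exact this.mono_left nhdsWithin_le_nhds
  filter_upwards [hp (interior_mem_nhds.2 hU), self_mem_nhdsWithin] with α hα hα0
  have hre : ((α : ℂ) + I * (β : ℂ)).re ≠ 0 := by simpa using hα0
  have := neBot_nhdsWithin_injective k ((α : ℂ) + I * (β : ℂ))
  refine hWc.mem_of_tendsto (tendsto_qDarboux hk hre rfl x t) ?_
  filter_upwards [eventually_separated hre,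
    nhdsWithin_le_nhds (isOpen_interior.mem_nhds hα)] with μ h1 h2
  exact hUW ⟨interior_subset h2, h1⟩

/-- With a single point all entries of column c share the same exponential, which can be pulled out
of the determinant. -/
theorem exists_det_jet_eq {n : ℕ} (s : Fin n → ℂ) (l j : Fin n → ℕ) (a : ℂ) :
    ∃ P : MvPolynomial (Fin 2) ℂ, ∀ x t : ℝ,
      Matrix.det (Matrix.of fun r c : Fin n =>
          jet (s c) (l r) (j c) a x t / ((l r).factorial : ℂ))
        = wave (∑ c, s c) x t a * MvPolynomial.eval ![(x : ℂ), (t : ℂ)] P := by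
  choose p hp using fun r c : Fin n => exists_jet_eq_wave_mul_eval (s c) (l r) (j c) a
  refine ⟨Matrix.det (Matrix.of fun r c =>
    MvPolynomial.C ((l r).factorial : ℂ)⁻¹ * p r c), fun x t => ?_⟩
  have e : wave (∑ c, s c) x t a = ∏ c, wave (s c) x t a := by
    simp only [wave, ← exp_sum, Finset.sum_mul]
  rw [e, RingHom.map_det, ← Matrix.det_mul_row]
  congr 1
  ext r c
  simp only [Matrix.of_apply, RingHom.mapMatrix_apply, Matrix.map_apply, map_mul,
    MvPolynomial.eval_C, hp]
  ring

theorem sum_neg_one_pow (k : ℕ) :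
    ∑ c : Fin (2 * k), (-1 : ℂ) ^ (2 * k - 1 - (c : ℕ)) = 0 := by
  rw [← Finset.sum_range (fun c => (-1 : ℂ) ^ (2 * k - 1 - c)),
    Finset.sum_range_reflect (fun c => (-1 : ℂ) ^ c), neg_one_geom_sum, if_pos (even_two_mul k)]

/-- Compared with the balanced alternating sum, the first sign -1 becomes +1. Hence only the
determinant of `entry12` retains an exponential, with phase doubled. -/
theorem sum_neg_one_pow_entry12 {k : ℕ} (hk : 1 ≤ k) :
    ∑ c : Fin (2 * k), (-1 : ℂ) ^ (if (c : ℕ) = 0 then 2 * k else 2 * k - 1 - (c : ℕ)) = 2 := by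
  rw [← sub_zero (∑ c : Fin (2 * k), _), ← sum_neg_one_pow k, ← Finset.sum_sub_distrib,
    Finset.sum_eq_single_of_mem (⟨0, by omega⟩ : Fin (2 * k)) (Finset.mem_univ _)]
  · simp only [if_true, Nat.sub_zero]
    rw [Even.neg_one_pow ⟨k, by omega⟩, Odd.neg_one_pow ⟨k - 1, by omega⟩]
    norm_num
  · intro c _ hc
    rw [if_neg fun h => hc (Fin.ext h), sub_self]

theorem wave_zero (x t : ℝ) (a : ℂ) : wave 0 x t a = 1 := by simp [wave]

/-- At a single point on the imaginary axis the solution is a rational function times an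
exponential. -/
theorem exists_rational_form {k : ℕ} (hk : 1 ≤ k) (a : ℂ) :
    ∃ P₁ P₂ Q : MvPolynomial (Fin 2) ℂ, ∀ x t : ℝ,
      confluentDet k 1 (fun _ => a) (entry11 k) x t
        = MvPolynomial.eval ![(x : ℂ), (t : ℂ)] P₁ ∧
      confluentDet k 1 (fun _ => a) (entry12 k) x t
        = wave (2 * I) x t a * MvPolynomial.eval ![(x : ℂ), (t : ℂ)] P₂ ∧
      confluentDet k 1 (fun _ => a) (entry21 k) x t
        = MvPolynomial.eval ![(x : ℂ), (t : ℂ)] Q := by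
  obtain ⟨P₁, h₁⟩ := exists_det_jet_eq (n := 2 * k)
    (fun c => I * (-1) ^ (2 * k - 1 - (c : ℕ))) (fun r => (r : ℕ) / 1)
    (fun c => 2 * k - 1 - (c : ℕ)) a
  obtain ⟨P₂, h₂⟩ := exists_det_jet_eq (n := 2 * k)
    (fun c => I * (-1) ^ (if (c : ℕ) = 0 then 2 * k else 2 * k - 1 - (c : ℕ)))
    (fun r => (r : ℕ) / 1) (fun c => if (c : ℕ) = 0 then 2 * k else 2 * k - 1 - (c : ℕ)) a
  obtain ⟨Q, h₃⟩ := exists_det_jet_eq (n := 2 * k)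
    (fun c => -(I * (-1) ^ (2 * k - 1 - (c : ℕ)))) (fun r => (r : ℕ) / 1)
    (fun c => 2 * k - 1 - (c : ℕ)) a
  refine ⟨P₁, P₂, Q, fun x t => ⟨?_, ?_, ?_⟩⟩
  · have := h₁ x t
    rw [← Finset.mul_sum, sum_neg_one_pow, mul_zero, wave_zero, one_mul] at this
    rw [← this]
    simp only [confluentDet, entry11_eq]; rfl
  · have := h₂ x t
    rw [← Finset.mul_sum, sum_neg_one_pow_entry12 hk, mul_comm I] at this
    rw [← this]
    simp only [confluentDet, entry12_eq]; rfl
  · have := h₃ x t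
    rw [Finset.sum_neg_distrib, ← Finset.mul_sum, sum_neg_one_pow, mul_zero, neg_zero, wave_zero,
      one_mul] at this
    rw [← this]
    simp only [confluentDet, entry21_eq]; rfl

theorem wave_two_mul_I (β x t : ℝ) : wave (2 * I) x t (I * (β : ℂ))
    = exp (2 * I * (β : ℂ) ^ 2 * (2 * (β : ℂ) ^ 2 * (t : ℂ) - (x : ℂ))) := by
  rw [wave, mul_pow, mul_pow, I_sq, I_pow_four]
  congr 1
  ring

end Rational

end DNLS

theorem proposition1 (k : ℕ) (hk : 1 ≤ k) :
    -- the formula at the eigenvalue `lam₁ = α₁ + i β₁`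
    (∀ (α₁ β₁ : ℝ), α₁ ≠ 0 → ∀ (lam₁ lam₂ : ℂ),
      lam₁ = (α₁ : ℂ) + Complex.I * (β₁ : ℂ) → lam₂ = -(starRingEnd ℂ) lam₁ →
        -- the denominator has no zero
        (∀ x t : ℝ, DNLS.delta21 k lam₁ lam₂ x t ≠ 0) ∧
        -- the formula is a solution
        DNLS.IsSolution (DNLS.qSame k lam₁ lam₂) ∧
        -- it arises from the Darboux transformation when all eigenvalues coalesce at `lam₁`
        (∀ x t : ℝ, Filter.Tendsto (fun μ : Fin k → ℂ => DNLS.qDarboux k μ x t)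
          (nhdsWithin (fun _ => lam₁) {μ : Fin k → ℂ | Function.Injective μ})
          (nhds (DNLS.qSame k lam₁ lam₂ x t)))) ∧
    -- the rational travelling solution, obtained in the limit `α₁ → 0`
    (∀ β₁ : ℝ, β₁ ≠ 0 → ∃ P Q : MvPolynomial (Fin 2) ℂ,
      let q₀ : ℝ → ℝ → ℂ := fun x t =>
        Complex.exp (2 * Complex.I * (β₁ : ℂ) ^ 2 * (2 * (β₁ : ℂ) ^ 2 * (t : ℂ) - (x : ℂ))) *
          (MvPolynomial.eval ![(x : ℂ), (t : ℂ)] P / MvPolynomial.eval ![(x : ℂ), (t : ℂ)] Q)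
      (∀ x t : ℝ, MvPolynomial.eval ![(x : ℂ), (t : ℂ)] Q ≠ 0) ∧
      DNLS.IsSolution q₀ ∧
      (∀ x t : ℝ, Filter.Tendsto
        (fun α₁ : ℝ => DNLS.qSame k ((α₁ : ℂ) + Complex.I * (β₁ : ℂ))
          (-(starRingEnd ℂ) ((α₁ : ℂ) + Complex.I * (β₁ : ℂ))) x t)
        (nhdsWithin 0 {0}ᶜ) (nhds (q₀ x t)))) := by
  refine ⟨fun α₁ β₁ hα lam₁ lam₂ h₁ h₂ => ?_, fun β₁ hβ => ?_⟩
  · have hre : lam₁.re ≠ 0 := by simpa [h₁] using hα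
    exact ⟨DNLS.delta21_ne_zero hk hre h₂, DNLS.isSolution_qSame hk hre h₂,
      DNLS.tendsto_qDarboux hk hre h₂⟩
  · have ha : I * (β₁ : ℂ) ≠ 0 := mul_ne_zero I_ne_zero (ofReal_ne_zero.2 hβ)
    have hc : -(starRingEnd ℂ) (I * (β₁ : ℂ)) = I * (β₁ : ℂ) := by simp
    have hne := DNLS.confluentDet_single_ne_zero hk ha hc
    obtain ⟨P₁, P₂, Q, h⟩ := DNLS.exists_rational_form hk (I * (β₁ : ℂ))
    have key (x t : ℝ) : Complex.exp (2 * Complex.I * (β₁ : ℂ) ^ 2 *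
          (2 * (β₁ : ℂ) ^ 2 * (t : ℂ) - (x : ℂ))) *
        (MvPolynomial.eval ![(x : ℂ), (t : ℂ)] (MvPolynomial.C (2 * I) * P₁ * P₂) /
          MvPolynomial.eval ![(x : ℂ), (t : ℂ)] (Q ^ 2))
        = 2 * I * (DNLS.confluentDet k 1 (fun _ => I * (β₁ : ℂ)) (DNLS.entry11 k) x t *
          DNLS.confluentDet k 1 (fun _ => I * (β₁ : ℂ)) (DNLS.entry12 k) x t)
          / DNLS.confluentDet k 1 (fun _ => I * (β₁ : ℂ)) (DNLS.entry21 k) x t ^ 2 := by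
      obtain ⟨e₁, e₂, e₃⟩ := h x t
      rw [e₁, e₂, e₃, DNLS.wave_two_mul_I, map_mul, map_mul, map_pow, MvPolynomial.eval_C]
      ring
    -- The polynomial parts of 2i times the first two determinants, and of the squared denominator.
    refine ⟨MvPolynomial.C (2 * I) * P₁ * P₂, Q ^ 2, ?_, ?_, ?_⟩
    · intro x t
      rw [map_pow, ← (h x t).2.2]
      exact pow_ne_zero 2 (hne x t)
    · simp only [key]
      exact (DNLS.symmetricPoints_single ha hc).isSolution hk hne
    · intro x t
      simp only [key]
      exact DNLS.tendsto_qSame hk hβ x t
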